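/- Let $n\ge 2$ be an integer and let $$\sigma_n(u)=\frac{1}{(n-1)!}\sum_{j=0}^n(-1)^j\binom{n}{j}\Big(\frac n2+u-j\Big)_+^{n-1},\qquad u\in\mathbb R,$$ be the central B-spline of order $n$, where $(u)_+=\max\{u,0\}$. For $w>0$ and $f\in L^p(\mathbb R)$ (real-valued, $1\le p\le\infty$), let $$(\mathcal D_w^{\sigma_n,\sigma_n}f)(x)=\sum_{k\in\mathbb Z}\sigma_n(wx-k)\,w\int_{\mathbb R}\sigma_n(wu-k)f(u)\,du,\qquad x\in\mathbb R.$$ For $\alpha>0$ put $r=\lfloor\alpha\rfloor+1$ and let $Lip^*(\alpha,L^p)$ be the set of all $f\in L^p(\mathbb R)$ such that $$\omega_r(f,\delta)_p:=\sup_{|t|\le\delta}\Big\|\sum_{j=0}^r\binom rj(-1)^{r-j}f(\cdot+jt)\Big\|_p=\mathcal O(\delta^\alpha),\qquad \delta\to0^+.$$ Then, for every $1\le p\le\infty$, every $f\in L^p(\mathbb R)$ and every $0<\alpha<2$, $$f\in Lip^*(\alpha,L^p)\quad\Longleftrightarrow\quad \|\mathcal D_w^{\sigma_n,\sigma_n}f-f\|_p=\mathcal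 O(w^{-\alpha}),\qquad w\to+\infty.$$ For $p=\infty$ the norm is the essential supremum; this includes the case of bounded uniformly continuous $f$ with the supremum norm. -/

import Mathlib

open MeasureTheory Filter Topology
open scoped ENNReal

/-- The central B-spline of order `n` (used for `n ≥ 2`),
`σₙ(u) = 1/(n-1)! ∑_{j=0}^n (-1)^j (n choose j) (n/2 + u - j)₊^(n-1)`. -/
noncomputable def centralBSpline (n : ℕ) (u : ℝ) : ℝ :=
  (1 / ((n - 1).factorial : ℝ)) *
    ∑ j ∈ Finset.range (n + 1),
      (-1 : ℝ) ^ j * (n.choose j : ℝ) * (max ((n : ℝ) / 2 + u - (j : ℝ)) 0) ^ (n - 1)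

/-- The Durrmeyer sampling operator based upon the kernels `φ` and `ψ`,
`(D_w f)(x) = ∑_{k ∈ ℤ} φ(wx - k) · w ∫ ψ(wu - k) f(u) du`. -/
noncomputable def durrmeyer (φ ψ : ℝ → ℝ) (w : ℝ) (f : ℝ → ℝ) (x : ℝ) : ℝ :=
  ∑' k : ℤ, φ (w * x - (k : ℝ)) * (w * ∫ u : ℝ, ψ (w * u - (k : ℝ)) * f u)

/-- The finite difference of order `r` and step `t`,
`Δ^r_t(f, x) = ∑_{j=0}^r (r choose j) (-1)^(r-j) f(x + j t)`. -/
def finiteDiff (r : ℕ) (t : ℝ) (f : ℝ → ℝ) (x : ℝ) : ℝ :=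
  ∑ j ∈ Finset.range (r + 1), (r.choose j : ℝ) * (-1 : ℝ) ^ (r - j) * f (x + (j : ℝ) * t)

/-- The modulus of smoothness of order `r` in `L^p(ℝ)`,
`ω_r(f, δ)_p = sup_{|t| ≤ δ} ‖Δ^r_t(f, ·)‖_p`, with values in `[0, ∞]`. -/
noncomputable def modulusOfSmoothness (r : ℕ) (p : ℝ≥0∞) (f : ℝ → ℝ) (δ : ℝ) : ℝ≥0∞ :=
  ⨆ (t : ℝ) (_ : |t| ≤ δ), eLpNorm (finiteDiff r t f) p volume

/-- The generalized Lipschitz space `Lip*(α, L^p)`: the functions `f ∈ L^p(ℝ)` such that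
`ω_r(f, δ)_p = O(δ^α)` as `δ → 0⁺`, where `r = ⌊α⌋ + 1` is the smallest integer
greater than `α`. -/
def LipStar (α : ℝ) (p : ℝ≥0∞) : Set (ℝ → ℝ) :=
  {f | MemLp f p volume ∧
    ∃ C : ℝ, ∀ᶠ δ in 𝓝[>] (0 : ℝ),
      modulusOfSmoothness (⌊α⌋₊ + 1) p f δ ≤ ENNReal.ofReal (C * δ ^ α)}

/-!
The Durrmeyer operator `A = D_w` built on the central B-spline `σ` of order `n` is compared with
second differences of `f`, in both directions and for each `w` separately; since `0 < α < 2`,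
membership in the Lipschitz space is a statement about second differences
(`mem_LipStar_iff_finiteDiff_two`). For `1 ≤ α` this is the definition. For `α < 1` the definition
uses first differences, and these are recovered from second ones by iterating
`2 Δ_t = Δ_{2t} - Δ_t²` (`exists_eLpNorm_finiteDiff_one_le`).

*Direct estimate* (`eLpNorm_durrmeyer_sub_le`). The operator reproduces affine functions and
satisfies the pointwise bound `|A f (x)| ≤ w ∫_{|u - x| ≤ n / w} |f|`, so it is bounded on `L^p`
uniformly in `w`. With `g` the second order Steklov mean of `f` with step `h = 1 / w`, the norms of
`g - f` and `h² g''` are at most the supremum of `‖Δ_s² f‖_p` over `0 < s ≤ h`. Subtracting from `g`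
its first order Taylor polynomial at `x` turns the same pointwise bound into
`‖A g - g‖_p ≤ C ‖h² g''‖_p`.

*Strong converse* (`exists_eLpNorm_finiteDiff_two_le`). Let `T` be the translation by `1 / w` and
`b i = ∫ σ(u) σ(u - i) du`. On its own range `A` is a discrete convolution,
`A (A f) = ∑ b i T^i (A f)` (`durrmeyer_durrmeyer`), so that `T^n (1 - ∑ b i T^i) (A f)` is a
translate of `A (f - A f)`, whose norm is at most a constant times `‖f - A f‖_p`. The `b i` are
nonnegative with sum `1`, and `b 1 > 0`; hence the polynomial `z^n (1 - ∑ b i z^i)` has no zero on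
the unit circle except `1`, of multiplicity at most two (`exists_symbol_factorization`). As `T` is
an isometry, `‖(T - z) φ‖ ≥ |1 - |z|| ‖φ‖`, and the linear factors with zeros off the circle can be
cancelled (`exists_le_eLpNorm_aeval_translation`). What remains bounds `‖(T - 1)² A f‖_p`, and hence
`‖Δ² f‖_p` at step `1 / w`, by `C ‖A f - f‖_p`. No smoothness of the splines is involved, so `n = 2`
is not exceptional.
-/

/-! ### Central B-splines -/

theorem integral_max_zero_pow (m : ℕ) (hm : 1 ≤ m) (a b : ℝ) :
    ∫ u in a..b, (max u 0) ^ m = (max b 0) ^ (m + 1) / (m + 1) - (max a 0) ^ (m + 1) / (m + 1) := by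
  have hcont : ∀ k : ℕ, Continuous fun x : ℝ => (max x 0) ^ k := fun k => by fun_prop
  have hne : ∀ y : ℝ, y ≠ 0 →
      HasDerivAt (fun x : ℝ => (max x 0) ^ (m + 1) / ((m : ℝ) + 1)) ((max y 0) ^ m) y := by
    intro y hy
    rcases lt_or_gt_of_ne hy with h | h
    · have h0 : (max y 0) ^ m = 0 := by
        rw [max_eq_right h.le, zero_pow (by omega)]
      rw [h0]
      refine (hasDerivAt_const y (0 : ℝ)).congr_of_eventuallyEq ?_
      filter_upwards [Iio_mem_nhds h] with x hx
      rw [max_eq_right (le_of_lt hx)]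
      simp
    · rw [max_eq_left h.le]
      have h1 : HasDerivAt (fun x : ℝ => x ^ (m + 1) / ((m : ℝ) + 1)) (y ^ m) y := by
        have h2 := (hasDerivAt_pow (m + 1) y).div_const ((m : ℝ) + 1)
        refine h2.congr_deriv ?_
        push_cast
        field_simp
      refine h1.congr_of_eventuallyEq ?_
      filter_upwards [Ioi_mem_nhds h] with x hx
      rw [max_eq_left (le_of_lt hx)]
  have hd : ∀ y : ℝ,
      HasDerivAt (fun x : ℝ => (max x 0) ^ (m + 1) / ((m : ℝ) + 1)) ((max y 0) ^ m) y := by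
    intro y
    by_cases hy : y = 0
    · subst hy
      exact hasDerivAt_of_hasDerivAt_of_ne (fun y hy => hne y hy)
        ((hcont (m + 1)).div_const _).continuousAt (hcont m).continuousAt
    · exact hne y hy
  exact intervalIntegral.integral_eq_sub_of_hasDerivAt (fun x _ => hd x)
    ((hcont m).intervalIntegrable _ _)

theorem continuous_centralBSpline (n : ℕ) : Continuous (centralBSpline n) := by
  unfold centralBSpline
  fun_prop

/-- The central B-splines arise from each other by averaging over unit intervals. -/
theorem centralBSpline_succ (n : ℕ) (hn : 2 ≤ n) (u : ℝ) :
    centralBSpline (n + 1) u = ∫ v in (u - 1 / 2)..(u + 1 / 2), centralBSpline n v := by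
  obtain ⟨m, rfl⟩ : ∃ m, n = m + 1 := ⟨n - 1, by omega⟩
  have hm : 1 ≤ m := by omega
  set G : ℝ → ℝ := fun x => (max x 0) ^ (m + 1) with hG
  have h1 : ∫ v in (u - 1 / 2)..(u + 1 / 2), centralBSpline (m + 1) v =
      (1 / (m.factorial : ℝ)) * ∑ j ∈ Finset.range (m + 2), (-1 : ℝ) ^ j * ((m + 1).choose j : ℝ) *
        (G (((m + 2 : ℕ) : ℝ) / 2 + u - j) / (m + 1) -
          G (((m + 2 : ℕ) : ℝ) / 2 + u - (j + 1 : ℕ)) / (m + 1)) := by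
    unfold centralBSpline
    rw [intervalIntegral.integral_const_mul, intervalIntegral.integral_finsetSum]
    · simp only [Nat.add_sub_cancel]
      congr 1
      refine Finset.sum_congr rfl fun j _ => ?_
      rw [intervalIntegral.integral_const_mul]
      congr 1
      have := intervalIntegral.integral_comp_add_right (a := u - 1 / 2) (b := u + 1 / 2)
        (fun x : ℝ => (max x 0) ^ m) (((m + 1 : ℕ) : ℝ) / 2 - j)
      have h2 : ∀ v : ℝ, ((m + 1 : ℕ) : ℝ) / 2 + v - j = v + (((m + 1 : ℕ) : ℝ) / 2 - j) :=
        fun v => by ring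
      simp only [h2, this]
      rw [integral_max_zero_pow m hm]
      simp only [hG]
      congr 4 <;> push_cast <;> ring
    · intro j _
      apply Continuous.intervalIntegrable
      fun_prop
  rw [h1]
  unfold centralBSpline
  simp only [Nat.add_sub_cancel]
  set A : ℕ → ℝ := fun j => G (((m + 2 : ℕ) : ℝ) / 2 + u - j) with hA
  have h3 : ∑ j ∈ Finset.range (m + 1 + 1 + 1), (-1 : ℝ) ^ j * ((m + 1 + 1).choose j : ℝ) * A j
      = ∑ j ∈ Finset.range (m + 2), (-1 : ℝ) ^ j * ((m + 1).choose j : ℝ) * (A j - A (j + 1)) := by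
    rw [Finset.sum_range_succ']
    simp only [Nat.choose_succ_succ' (m + 1)]
    have h4 : ∑ j ∈ Finset.range (m + 2), (-1 : ℝ) ^ j * ((m + 1).choose j : ℝ) * A j
      = ∑ j ∈ Finset.range (m + 2), (-1 : ℝ) ^ (j + 1) * ((m + 1).choose (j + 1) : ℝ) * A (j + 1)
        + A 0 := by
      have h6 := Finset.sum_range_succ'
        (fun j => (-1 : ℝ) ^ j * ((m + 1).choose j : ℝ) * A j) (m + 2)
      rw [Finset.sum_range_succ _ (m + 2)] at h6
      simpa using h6
    simp only [mul_sub, Finset.sum_sub_distrib]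
    rw [h4]
    simp only [Nat.cast_add, pow_succ, mul_add, add_mul, Finset.sum_add_distrib]
    simp
    ring
  have h5 : ((m + 1).factorial : ℝ) = (m + 1) * m.factorial := by
    push_cast [Nat.factorial_succ]; ring
  simp only [hA, hG] at h3
  rw [h3, h5]
  simp only [hG, ← sub_div, mul_div_assoc']
  rw [← Finset.sum_div]
  field_simp

theorem centralBSpline_two (u : ℝ) : centralBSpline 2 u = max (1 - |u|) 0 := by
  unfold centralBSpline
  simp only [Finset.sum_range_succ, Finset.range_zero, Finset.sum_empty]
  norm_num
  rcases abs_cases u with ⟨h, h'⟩ | ⟨h, h'⟩ <;> rw [h] <;> simp only [max_def] <;>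
    split_ifs <;> linarith

theorem centralBSpline_eq_zero {n : ℕ} (hn : 2 ≤ n) {u : ℝ} (hu : (n : ℝ) / 2 ≤ |u|) :
    centralBSpline n u = 0 := by
  induction n, hn using Nat.le_induction generalizing u with
  | base =>
    rw [centralBSpline_two]
    push_cast at hu
    exact max_eq_right (by linarith)
  | succ n hn ih =>
    rw [centralBSpline_succ n hn]
    refine (intervalIntegral.integral_congr (g := fun _ => (0 : ℝ)) fun v hv => ?_).trans (by simp)
    rw [Set.uIcc_of_le (by linarith)] at hv
    refine ih ?_
    push_cast at hu
    rcases le_abs'.1 hu with h | h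
    · exact le_abs.2 (Or.inr (by linarith [hv.2]))
    · exact le_abs.2 (Or.inl (by linarith [hv.1]))

theorem centralBSpline_pos_and_nonneg {n : ℕ} (hn : 2 ≤ n) :
    (∀ u, 0 ≤ centralBSpline n u) ∧ ∀ u, |u| < (n : ℝ) / 2 → 0 < centralBSpline n u := by
  induction n, hn using Nat.le_induction with
  | base =>
    simp only [centralBSpline_two]
    refine ⟨fun u => le_max_right _ _, fun u hu => lt_max_of_lt_left ?_⟩
    push_cast at hu
    linarith
  | succ n hn ih =>
    have hn0 : (0 : ℝ) < n := by exact_mod_cast (by omega : 0 < n)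
    refine ⟨fun u => ?_, fun u hu => ?_⟩
    · rw [centralBSpline_succ n hn]
      exact intervalIntegral.integral_nonneg (by linarith) fun v _ => ih.1 v
    · rw [centralBSpline_succ n hn]
      refine intervalIntegral.integral_pos (by linarith)
        (continuous_centralBSpline n).continuousOn (fun v _ => ih.1 v) ?_
      push_cast at hu
      -- shrinking `u` towards the origin by the ratio of the two support radii
      refine ⟨u * (n / (n + 1)), ?_, ih.2 _ ?_⟩
      · have h1 : u * (n / (n + 1)) = u - u / (n + 1) := by field_simp; ring
        have h2 : |u / (n + 1)| ≤ 1 / 2 := by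
          rw [abs_div, abs_of_pos (by linarith : (0 : ℝ) < n + 1), div_le_iff₀ (by linarith)]
          linarith
        rw [h1]
        constructor <;> linarith [(abs_le.1 h2).1, (abs_le.1 h2).2]
      · rw [abs_mul, abs_of_pos (by positivity : (0 : ℝ) < n / (n + 1)), mul_div_assoc',
          div_lt_iff₀ (by linarith)]
        nlinarith

theorem centralBSpline_nonneg {n : ℕ} (hn : 2 ≤ n) (u : ℝ) : 0 ≤ centralBSpline n u :=
  (centralBSpline_pos_and_nonneg hn).1 u

theorem centralBSpline_pos {n : ℕ} (hn : 2 ≤ n) {u : ℝ} (hu : |u| < (n : ℝ) / 2) :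
    0 < centralBSpline n u :=
  (centralBSpline_pos_and_nonneg hn).2 u hu

theorem centralBSpline_neg {n : ℕ} (hn : 2 ≤ n) (u : ℝ) :
    centralBSpline n (-u) = centralBSpline n u := by
  induction n, hn using Nat.le_induction generalizing u with
  | base => simp [centralBSpline_two]
  | succ n hn ih =>
    rw [centralBSpline_succ n hn, centralBSpline_succ n hn]
    have := intervalIntegral.integral_comp_neg (a := u - 1 / 2) (b := u + 1 / 2) (centralBSpline n)
    simp only [ih] at this
    rw [this]
    congr 1 <;> ring

theorem hasCompactSupport_centralBSpline {n : ℕ} (hn : 2 ≤ n) :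
    HasCompactSupport (centralBSpline n) := by
  refine HasCompactSupport.of_support_subset_isCompact (isCompact_Icc (a := -(n : ℝ) / 2)
    (b := (n : ℝ) / 2)) fun u hu => ?_
  have : |u| < (n : ℝ) / 2 := by
    by_contra h
    exact hu (centralBSpline_eq_zero hn (not_lt.1 h))
  have h2 := abs_lt.1 this
  constructor <;> linarith

theorem integrable_centralBSpline {n : ℕ} (hn : 2 ≤ n) : Integrable (centralBSpline n) :=
  (continuous_centralBSpline n).integrable_of_hasCompactSupport
    (hasCompactSupport_centralBSpline hn)

/-- Integer translates of a central B-spline of order `n` that do not vanish at `v`, for all `v`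
within distance `1` of `u`, have indices in a common finite set. -/
theorem centralBSpline_sub_int_eq_zero {n : ℕ} (hn : 2 ≤ n) {u v : ℝ} (huv : |v - u| ≤ 1) {k : ℤ}
    (hk : k ∉ Finset.Icc ⌊u - n - 2⌋ ⌈u + n + 2⌉) : centralBSpline n (v - k) = 0 := by
  refine centralBSpline_eq_zero hn ?_
  by_contra h
  have h2 := abs_lt.1 (not_le.1 h)
  have h3 := abs_le.1 huv
  have hn0 : (0 : ℝ) ≤ n := by positivity
  refine hk (Finset.mem_Icc.2 ⟨?_, ?_⟩)
  · have : ((⌊u - n - 2⌋ : ℤ) : ℝ) ≤ k := (Int.floor_le _).trans (by linarith)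
    exact_mod_cast this
  · have : (k : ℝ) ≤ ((⌈u + n + 2⌉ : ℤ) : ℝ) := le_trans (by linarith) (Int.le_ceil _)
    exact_mod_cast this

theorem support_centralBSpline_translates_finite {n : ℕ} (hn : 2 ≤ n) (u : ℝ) :
    (Function.support fun k : ℤ => centralBSpline n (u - k)).Finite := by
  refine (Finset.finite_toSet (Finset.Icc ⌊u - n - 2⌋ ⌈u + n + 2⌉)).subset fun k hk => ?_
  by_contra h
  exact hk (centralBSpline_sub_int_eq_zero hn (by simp) h)

theorem summable_centralBSpline_mul {n : ℕ} (hn : 2 ≤ n) (u : ℝ) (c : ℤ → ℝ) :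
    Summable fun k : ℤ => centralBSpline n (u - k) * c k :=
  summable_of_hasFiniteSupport ((support_centralBSpline_translates_finite hn u).subset
    (Function.support_mul_subset_left _ _))

/-- The integer translates of a central B-spline reproduce affine functions. -/
theorem tsum_centralBSpline_mul_affine {n : ℕ} (hn : 2 ≤ n) (a b u : ℝ) :
    ∑' k : ℤ, centralBSpline n (u - k) * (a + b * k) = a + b * u := by
  induction n, hn using Nat.le_induction generalizing u with
  | base =>
    have h1 : (⌊u⌋ : ℝ) ≤ u := Int.floor_le u
    have h2 : u < ⌊u⌋ + 1 := Int.lt_floor_add_one u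
    rw [tsum_eq_sum (s := {⌊u⌋, ⌊u⌋ + 1}), Finset.sum_pair (by simp)]
    · rw [centralBSpline_two, centralBSpline_two]
      push_cast
      rw [abs_of_nonneg (by linarith), abs_of_nonpos (by linarith), max_eq_left (by linarith),
        max_eq_left (by linarith)]
      ring
    · intro k hk
      simp only [Finset.mem_insert, Finset.mem_singleton, not_or] at hk
      rw [centralBSpline_eq_zero le_rfl, zero_mul]
      push_cast
      rcases lt_or_gt_of_ne hk.1 with h | h
      · have : (k : ℝ) + 1 ≤ ⌊u⌋ := by exact_mod_cast h
        exact le_abs.2 (Or.inl (by linarith))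
      · have : (⌊u⌋ : ℝ) + 1 + 1 ≤ k := by exact_mod_cast (by omega : ⌊u⌋ + 1 + 1 ≤ k)
        exact le_abs.2 (Or.inr (by linarith))
  | succ n hn ih =>
    set K := Finset.Icc ⌊u - n - 2⌋ ⌈u + n + 2⌉ with hK
    have hsucc : ∀ k : ℤ, centralBSpline (n + 1) (u - k) =
        ∫ v in (u - 1 / 2)..(u + 1 / 2), centralBSpline n (v - k) := by
      intro k
      rw [centralBSpline_succ n hn, intervalIntegral.integral_comp_sub_right]
      congr 1 <;> ring
    have hmem : ∀ v ∈ Set.uIcc (u - 1 / 2) (u + 1 / 2), |v - u| ≤ 1 := by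
      intro v hv
      rw [Set.uIcc_of_le (by linarith)] at hv
      exact abs_le.2 ⟨by linarith [hv.1], by linarith [hv.2]⟩
    rw [tsum_eq_sum (s := K)]
    · have h1 : ∀ k ∈ K, centralBSpline (n + 1) (u - k) * (a + b * k) =
          ∫ v in (u - 1 / 2)..(u + 1 / 2), centralBSpline n (v - k) * (a + b * k) := by
        intro k _
        rw [intervalIntegral.integral_mul_const, hsucc]
      have hc := continuous_centralBSpline n
      rw [Finset.sum_congr rfl h1, ← intervalIntegral.integral_finsetSum]
      · have h2 : ∫ v in (u - 1 / 2)..(u + 1 / 2), ∑ k ∈ K, centralBSpline n (v - k) * (a + b * k)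
            = ∫ v in (u - 1 / 2)..(u + 1 / 2), (a + b * v) := by
          refine intervalIntegral.integral_congr fun v hv => ?_
          rw [← ih v, tsum_eq_sum (s := K)]
          intro k hk
          rw [centralBSpline_sub_int_eq_zero hn (hmem v hv) hk, zero_mul]
        rw [h2, intervalIntegral.integral_add (by simp) (by
          apply Continuous.intervalIntegrable; fun_prop), intervalIntegral.integral_const_mul]
        simp
        ring
      · intro k _
        apply Continuous.intervalIntegrable
        fun_prop
    · intro k hk
      rw [hsucc, intervalIntegral.integral_congr (g := fun _ => (0 : ℝ)) fun v hv =>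
        centralBSpline_sub_int_eq_zero hn (hmem v hv) hk]
      simp

theorem tsum_centralBSpline {n : ℕ} (hn : 2 ≤ n) (u : ℝ) :
    ∑' k : ℤ, centralBSpline n (u - k) = 1 := by
  simpa using tsum_centralBSpline_mul_affine hn 1 0 u

theorem summable_centralBSpline {n : ℕ} (hn : 2 ≤ n) (u : ℝ) :
    Summable fun k : ℤ => centralBSpline n (u - k) := by
  simpa using summable_centralBSpline_mul hn u fun _ => 1

theorem centralBSpline_le_one {n : ℕ} (hn : 2 ≤ n) (u : ℝ) : centralBSpline n u ≤ 1 := by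
  have := (summable_centralBSpline hn u).le_tsum 0 fun k _ => centralBSpline_nonneg hn _
  rw [tsum_centralBSpline hn] at this
  simpa using this

theorem integral_centralBSpline {n : ℕ} (hn : 2 ≤ n) : ∫ u, centralBSpline n u = 1 := by
  have hc := continuous_centralBSpline n
  have h := (integrable_centralBSpline hn).hasSum_intervalIntegral_comp_add_int
  rw [← (Equiv.neg ℤ).hasSum_iff] at h
  have hmem : ∀ v ∈ Set.uIcc (0 : ℝ) 1, |v - 0| ≤ 1 := by
    intro v hv
    rw [Set.uIcc_of_le zero_le_one] at hv
    exact abs_le.2 ⟨by linarith [hv.1], by linarith [hv.2]⟩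
  set K := Finset.Icc ⌊(0 : ℝ) - n - 2⌋ ⌈(0 : ℝ) + n + 2⌉ with hK
  simp only [Function.comp_def, Equiv.neg_apply, Int.cast_neg, ← sub_eq_add_neg] at h
  rw [← h.tsum_eq, tsum_eq_sum (s := K), ← intervalIntegral.integral_finsetSum]
  · rw [intervalIntegral.integral_congr (g := fun _ => (1 : ℝ))]
    · simp
    · intro v hv
      simp only
      rw [← tsum_centralBSpline hn v, tsum_eq_sum (s := K)]
      exact fun k hk => centralBSpline_sub_int_eq_zero hn (hmem v hv) hk
  · intro k _
    apply Continuous.intervalIntegrable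
    fun_prop
  · intro k hk
    rw [intervalIntegral.integral_congr (g := fun _ => (0 : ℝ)) fun v hv =>
      centralBSpline_sub_int_eq_zero hn (hmem v hv) hk]
    simp

theorem integral_id_mul_centralBSpline {n : ℕ} (hn : 2 ≤ n) :
    ∫ u, u * centralBSpline n u = 0 := by
  have := integral_neg_eq_self (fun u => u * centralBSpline n u) volume
  simp only [centralBSpline_neg hn, neg_mul, integral_neg] at this
  linarith

/-! ### Minkowski inequality and boundedness of the Durrmeyer operators -/

/-- Minkowski's integral inequality for a finite measure on the parameters. -/
theorem eLpNorm_lintegral_le {S : Type*} [MeasurableSpace S] (μ : Measure S) [IsFiniteMeasure μ]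
    {X : Type*} [MeasurableSpace X] (ν : Measure X) [SFinite ν]
    {F : S → X → ℝ≥0∞} (hF : Measurable (Function.uncurry F)) {p : ℝ≥0∞} (hp : 1 ≤ p)
    {M : ℝ≥0∞} (hM : ∀ᵐ s ∂μ, eLpNorm (F s) p ν ≤ M) :
    eLpNorm (fun x => ∫⁻ s, F s x ∂μ) p ν ≤ μ Set.univ * M := by
  have hF' : Measurable (Function.uncurry fun x s => F s x) := hF.comp measurable_swap
  by_cases hpt : p = ∞
  · subst hpt
    rw [eLpNorm_exponent_top]
    have h1 : ∀ᵐ x ∂ν, ∀ᵐ s ∂μ, F s x ≤ M := by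
      refine (Measure.ae_ae_comm (p := fun s x => F s x ≤ M)
        (measurableSet_le hF measurable_const)).1 ?_
      filter_upwards [hM] with s hs
      rw [eLpNorm_exponent_top] at hs
      filter_upwards [ae_le_eLpNormEssSup (f := F s) (μ := ν)] with x hx
      exact hx.trans hs
    refine essSup_le_of_ae_le _ ?_
    filter_upwards [h1] with x hx
    simp only [enorm_eq_self]
    calc ∫⁻ s, F s x ∂μ ≤ ∫⁻ _, M ∂μ := lintegral_mono_ae hx
      _ = μ Set.univ * M := by rw [lintegral_const, mul_comm]
  · have hp0 : p ≠ 0 := (zero_lt_one.trans_le hp).ne'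
    have hq1 : 1 ≤ p.toReal := by
      rw [← ENNReal.toReal_one]
      exact ENNReal.toReal_mono hpt hp
    have hq0 : 0 < p.toReal := zero_lt_one.trans_le hq1
    have hM' : ∀ᵐ s ∂μ, ∫⁻ x, F s x ^ p.toReal ∂ν ≤ M ^ p.toReal := by
      filter_upwards [hM] with s hs
      rw [eLpNorm_eq_lintegral_rpow_enorm_toReal hp0 hpt] at hs
      simp only [enorm_eq_self] at hs
      rwa [one_div, ENNReal.rpow_inv_le_iff hq0] at hs
    have h1 : ∀ x, (∫⁻ s, F s x ∂μ) ^ p.toReal ≤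
        μ Set.univ ^ (p.toReal - 1) * ∫⁻ s, F s x ^ p.toReal ∂μ := by
      intro x
      have h2 := eLpNorm_le_eLpNorm_mul_rpow_measure_univ (μ := μ) hp
        (f := fun s => F s x) (hF'.of_uncurry_left (x := x)).aestronglyMeasurable
      rw [eLpNorm_one_eq_lintegral_enorm, eLpNorm_eq_lintegral_rpow_enorm_toReal hp0 hpt] at h2
      simp only [enorm_eq_self] at h2
      refine (ENNReal.rpow_le_rpow h2 hq0.le).trans (le_of_eq ?_)
      rw [ENNReal.mul_rpow_of_nonneg _ _ hq0.le, ← ENNReal.rpow_mul, ← ENNReal.rpow_mul, mul_comm]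
      congr 2
      · simp; field_simp
      · field_simp; simp
    rw [eLpNorm_eq_lintegral_rpow_enorm_toReal hp0 hpt, one_div, ENNReal.rpow_inv_le_iff hq0]
    simp only [enorm_eq_self]
    calc ∫⁻ x, (∫⁻ s, F s x ∂μ) ^ p.toReal ∂ν
        ≤ ∫⁻ x, μ Set.univ ^ (p.toReal - 1) * ∫⁻ s, F s x ^ p.toReal ∂μ ∂ν := lintegral_mono h1
      _ = μ Set.univ ^ (p.toReal - 1) * ∫⁻ x, ∫⁻ s, F s x ^ p.toReal ∂μ ∂ν :=
          lintegral_const_mul _ (hF'.pow_const _).lintegral_prod_right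
      _ = μ Set.univ ^ (p.toReal - 1) * ∫⁻ s, ∫⁻ x, F s x ^ p.toReal ∂ν ∂μ := by
          rw [lintegral_lintegral_swap (hF'.pow_const _).aemeasurable]
      _ ≤ μ Set.univ ^ (p.toReal - 1) * ∫⁻ _, M ^ p.toReal ∂μ := by
          exact mul_le_mul_right (lintegral_mono_ae hM') _
      _ = (μ Set.univ * M) ^ p.toReal := by
          rw [lintegral_const, ENNReal.mul_rpow_of_nonneg _ _ hq0.le, mul_left_comm,
            mul_comm _ (M ^ _)]
          congr 1
          by_cases h0 : μ Set.univ = 0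
          · simp [h0, hq0]
          · nth_rw 2 [← ENNReal.rpow_one (μ Set.univ)]
            rw [← ENNReal.rpow_add _ _ h0 (measure_ne_top _ _), sub_add_cancel]

theorem eLpNorm_comp_add_right {E : Type*} [NormedAddCommGroup E] {f : ℝ → E}
    (hf : AEStronglyMeasurable f volume) (p : ℝ≥0∞) (a : ℝ) :
    eLpNorm (fun x => f (x + a)) p volume = eLpNorm f p volume :=
  eLpNorm_comp_measurePreserving hf (measurePreserving_add_right volume a)

/-- Moving averages of `|f|` over intervals of radius `a` are bounded on `L^p`. -/
theorem eLpNorm_integral_Icc_abs_le {f : ℝ → ℝ} (hfm : Measurable f)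
    (hf : LocallyIntegrable f volume) {p : ℝ≥0∞} (hp : 1 ≤ p) (a : ℝ) :
    eLpNorm (fun x => ∫ u in Set.Icc (x - a) (x + a), |f u|) p volume ≤
      ENNReal.ofReal (2 * a) * eLpNorm f p volume := by
  set μ : Measure ℝ := volume.restrict (Set.Icc (-a) a) with hμ
  have h1 : ∀ x, ‖∫ u in Set.Icc (x - a) (x + a), |f u|‖ₑ = ∫⁻ s, ‖f (x + s)‖ₑ ∂μ := by
    intro x
    have h2 : ∫⁻ u in Set.Icc (x - a) (x + a), ‖f u‖ₑ = ∫⁻ s, ‖f (x + s)‖ₑ ∂μ := by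
      have h3 := (measurePreserving_add_left volume x).setLIntegral_comp_preimage
        (measurableSet_Icc (a := x - a) (b := x + a)) hfm.enorm
      rw [← h3, hμ]
      congr 2
      ext s
      simp only [Set.mem_preimage, Set.mem_Icc]
      constructor <;> rintro ⟨h4, h5⟩ <;> constructor <;> linarith
    rw [← h2, Real.enorm_of_nonneg (integral_nonneg fun _ => abs_nonneg _),
      ofReal_integral_eq_lintegral_ofReal (hf.integrableOn_isCompact isCompact_Icc).abs
        (ae_of_all _ fun _ => abs_nonneg _)]
    simp only [← Real.norm_eq_abs, ofReal_norm]
  have h4 : eLpNorm (fun x => ∫ u in Set.Icc (x - a) (x + a), |f u|) p volume =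
      eLpNorm (fun x => ∫⁻ s, ‖f (x + s)‖ₑ ∂μ) p volume :=
    eLpNorm_congr_enorm_ae (ae_of_all _ fun x => by simp only [h1, enorm_eq_self])
  have h5 : μ Set.univ = ENNReal.ofReal (2 * a) := by
    rw [hμ, Measure.restrict_apply_univ, Real.volume_Icc]
    congr 1
    ring
  have : IsFiniteMeasure μ := ⟨by rw [h5]; exact ENNReal.ofReal_lt_top⟩
  rw [h4, ← h5]
  refine eLpNorm_lintegral_le μ volume (F := fun s x => ‖f (x + s)‖ₑ)
    (hfm.comp (measurable_snd.add measurable_fst)).enorm hp (ae_of_all _ fun s => ?_)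
  rw [eLpNorm_enorm (fun x => f (x + s)), eLpNorm_comp_add_right hfm.aestronglyMeasurable]

theorem mul_integral_comp_mul_sub (g : ℝ → ℝ) {w : ℝ} (hw : 0 < w) (a : ℝ) :
    w * ∫ u, g (w * u - a) = ∫ v, g v := by
  rw [Measure.integral_comp_mul_left (fun v => g (v - a)), integral_sub_right_eq_self,
    abs_of_pos (inv_pos.2 hw), smul_eq_mul, mul_inv_cancel_left₀ hw.ne']

section Durrmeyer

variable {n : ℕ} {w : ℝ} {f g : ℝ → ℝ}

theorem integrable_centralBSpline_mul (hn : 2 ≤ n) (hw : 0 < w) (hf : LocallyIntegrable f volume)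
    (k : ℤ) : Integrable fun u => centralBSpline n (w * u - k) * f u := by
  have hc := continuous_centralBSpline n
  refine hf.integrable_smul_left_of_hasCompactSupport
    (g := fun u => centralBSpline n (w * u - k)) (by fun_prop) ?_
  have := (hasCompactSupport_centralBSpline hn).comp_homeomorph
    ((Homeomorph.mulLeft₀ w hw.ne').trans (Homeomorph.addRight (-(k : ℝ))))
  simpa [Function.comp_def, sub_eq_add_neg] using this

theorem durrmeyer_sub (hn : 2 ≤ n) (hw : 0 < w) (hf : LocallyIntegrable f volume)
    (hg : LocallyIntegrable g volume) (x : ℝ) :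
    durrmeyer (centralBSpline n) (centralBSpline n) w (fun u => f u - g u) x =
      durrmeyer (centralBSpline n) (centralBSpline n) w f x -
        durrmeyer (centralBSpline n) (centralBSpline n) w g x := by
  unfold durrmeyer
  rw [← (summable_centralBSpline_mul hn _ _).tsum_sub (summable_centralBSpline_mul hn _ _)]
  congr 1
  ext k
  simp only [mul_sub]
  rw [integral_sub (integrable_centralBSpline_mul hn hw hf k)
    (integrable_centralBSpline_mul hn hw hg k)]
  ring

theorem durrmeyer_affine (hn : 2 ≤ n) (hw : 0 < w) (a b y x : ℝ) :
    durrmeyer (centralBSpline n) (centralBSpline n) w (fun u => a + b * (u - y)) x =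
      a + b * (x - y) := by
  have h1 : ∀ k : ℤ, w * ∫ u, centralBSpline n (w * u - k) * (a + b * (u - y)) =
      (a - b * y) + (b / w) * k := by
    intro k
    have h2 := mul_integral_comp_mul_sub
      (fun v => centralBSpline n v * (a + b * ((v + k) / w - y))) hw k
    have h3 : ∀ u, (w * u - k + k) / w = u := fun u => by field_simp; ring
    simp only [h3] at h2
    rw [h2]
    have h4 : ∀ v, centralBSpline n v * (a + b * ((v + k) / w - y)) =
        ((a - b * y) + (b / w) * k) * centralBSpline n v + (b / w) * (v * centralBSpline n v) :=
      fun v => by field_simp; ring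
    have hi : Integrable fun v => v * centralBSpline n v :=
      ((continuous_id.mul (continuous_centralBSpline n)).integrable_of_hasCompactSupport
        (hasCompactSupport_centralBSpline hn).mul_left)
    simp only [h4]
    rw [integral_add ((integrable_centralBSpline hn).const_mul _) (hi.const_mul _),
      integral_const_mul, integral_const_mul, integral_centralBSpline hn,
      integral_id_mul_centralBSpline hn]
    ring
  unfold durrmeyer
  simp only [h1]
  rw [tsum_centralBSpline_mul_affine hn]
  field_simp
  ring

/-- The coefficients that matter at `x` only see `f` within distance `n / w` of `x`, and the
translates of `σ` sum to one. -/
theorem abs_durrmeyer_le (hn : 2 ≤ n) (hw : 0 < w) (hf : LocallyIntegrable f volume) (x : ℝ) :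
    |durrmeyer (centralBSpline n) (centralBSpline n) w f x| ≤
      w * ∫ u in Set.Icc (x - n / w) (x + n / w), |f u| := by
  unfold durrmeyer
  set B := w * ∫ u in Set.Icc (x - n / w) (x + n / w), |f u| with hB
  have h1 : ∀ k : ℤ, ‖centralBSpline n (w * x - k) *
      (w * ∫ u, centralBSpline n (w * u - k) * f u)‖ ≤ centralBSpline n (w * x - k) * B := by
    intro k
    rw [norm_mul, Real.norm_of_nonneg (centralBSpline_nonneg hn _)]
    by_cases h0 : centralBSpline n (w * x - k) = 0
    · simp [h0]
    refine mul_le_mul_of_nonneg_left ?_ (centralBSpline_nonneg hn _)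
    have hx : |w * x - k| < (n : ℝ) / 2 := by
      by_contra h
      exact h0 (centralBSpline_eq_zero hn (not_lt.1 h))
    rw [norm_mul, Real.norm_of_nonneg hw.le, hB]
    refine mul_le_mul_of_nonneg_left ?_ hw.le
    rw [← integral_indicator measurableSet_Icc]
    refine norm_integral_le_of_norm_le
      ((integrable_indicator_iff measurableSet_Icc).2
        (hf.integrableOn_isCompact isCompact_Icc).abs)
      (ae_of_all _ fun u => ?_)
    rw [norm_mul, Real.norm_of_nonneg (centralBSpline_nonneg hn _), Real.norm_eq_abs]
    by_cases hu : u ∈ Set.Icc (x - n / w) (x + n / w)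
    · rw [Set.indicator_of_mem hu]
      exact mul_le_of_le_one_left (abs_nonneg _) (centralBSpline_le_one hn _)
    · rw [Set.indicator_of_notMem hu, centralBSpline_eq_zero hn, zero_mul]
      by_contra h
      refine hu ?_
      have h2 := abs_lt.1 (not_le.1 h)
      have h3 := abs_lt.1 hx
      constructor
      · rw [sub_le_iff_le_add, ← sub_le_iff_le_add', le_div_iff₀ hw]
        nlinarith
      · rw [← sub_le_iff_le_add', le_div_iff₀ hw]
        nlinarith
  have h2 : Summable fun k : ℤ => centralBSpline n (w * x - k) * B :=
    summable_centralBSpline_mul hn _ _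
  have h3 := tsum_of_norm_bounded h2.hasSum h1
  rwa [tsum_mul_right, tsum_centralBSpline hn, one_mul] at h3

theorem measurable_durrmeyer (hn : 2 ≤ n) :
    Measurable (durrmeyer (centralBSpline n) (centralBSpline n) w f) := by
  have hc := continuous_centralBSpline n
  refine measurable_of_tendsto_metrizable' (atTop : Filter (Finset ℤ))
    (f := fun (s : Finset ℤ) x => ∑ k ∈ s, centralBSpline n (w * x - k) *
      (w * ∫ u, centralBSpline n (w * u - k) * f u)) (fun s => ?_) ?_
  · refine Continuous.measurable ?_
    fun_prop
  · rw [tendsto_pi_nhds]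
    intro x
    simpa [HasSum, durrmeyer] using (summable_centralBSpline_mul hn (w * x)
      (fun k => w * ∫ u, centralBSpline n (w * u - k) * f u)).hasSum

/-- The Durrmeyer operators are bounded on `L^p`, uniformly in `w`. -/
theorem eLpNorm_durrmeyer_le (hn : 2 ≤ n) (hw : 0 < w) (hfm : Measurable f) {p : ℝ≥0∞}
    (hp : 1 ≤ p) (hf : MemLp f p volume) :
    eLpNorm (durrmeyer (centralBSpline n) (centralBSpline n) w f) p volume ≤
      ENNReal.ofReal (2 * n) * eLpNorm f p volume := by
  have hloc := hf.locallyIntegrable hp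
  have h1 : eLpNorm (durrmeyer (centralBSpline n) (centralBSpline n) w f) p volume ≤
      eLpNorm (fun x => w * ∫ u in Set.Icc (x - n / w) (x + n / w), |f u|) p volume :=
    eLpNorm_mono_real fun x => abs_durrmeyer_le hn hw hloc x
  refine h1.trans ?_
  have h2 := eLpNorm_integral_Icc_abs_le hfm hloc hp (n / w)
  have h3 := eLpNorm_const_smul w (fun x => ∫ u in Set.Icc (x - n / w) (x + n / w), |f u|) p volume
  simp only [Pi.smul_def, smul_eq_mul] at h3
  rw [h3, Real.enorm_of_nonneg hw.le]
  refine (mul_le_mul_right h2 _).trans (le_of_eq ?_)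
  rw [← mul_assoc, ← ENNReal.ofReal_mul hw.le]
  congr 2
  field_simp

theorem memLp_durrmeyer (hn : 2 ≤ n) (hw : 0 < w) (hfm : Measurable f) {p : ℝ≥0∞}
    (hp : 1 ≤ p) (hf : MemLp f p volume) :
    MemLp (durrmeyer (centralBSpline n) (centralBSpline n) w f) p volume :=
  ⟨(measurable_durrmeyer hn).aestronglyMeasurable, (eLpNorm_durrmeyer_le hn hw hfm hp hf).trans_lt
    (ENNReal.mul_lt_top ENNReal.ofReal_lt_top hf.2)⟩

end Durrmeyer

/-! ### Steklov means and the direct estimate -/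

/-- The second order Steklov mean of `f` with step `h`: the average of `f (x + s)` against the
triangular weight `(h - |s|)₊ / h²`, folded at the origin. -/
noncomputable def steklovMean (h : ℝ) (f : ℝ → ℝ) (x : ℝ) : ℝ :=
  (∫ s in (0 : ℝ)..h, (h - s) * (f (x + s) + f (x - s))) / h ^ 2

/-- The symmetric second difference. -/
def centralDiff (s : ℝ) (f : ℝ → ℝ) (x : ℝ) : ℝ := f (x + s) - 2 * f x + f (x - s)

section Steklov

variable {f : ℝ → ℝ} {h : ℝ}

theorem intervalIntegrable_of_locallyIntegrable (hf : LocallyIntegrable f volume) (a b : ℝ) :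
    IntervalIntegrable f volume a b :=
  (hf.integrableOn_isCompact isCompact_uIcc).intervalIntegrable

theorem intervalIntegrable_mul (hf : LocallyIntegrable f volume) {φ : ℝ → ℝ} (hφ : Continuous φ)
    (a b : ℝ) : IntervalIntegrable (fun v => φ v * f v) volume a b :=
  (intervalIntegrable_of_locallyIntegrable hf (a) (b)).continuousOn_mul hφ.continuousOn

theorem intervalIntegrable_comp_add (hf : LocallyIntegrable f volume) (x a b : ℝ) :
    IntervalIntegrable (fun s => f (x + s)) volume a b := by
  have := (intervalIntegrable_of_locallyIntegrable hf (x + a) (x + b)).comp_add_left x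
  simpa using this

theorem intervalIntegrable_comp_sub (hf : LocallyIntegrable f volume) (x a b : ℝ) :
    IntervalIntegrable (fun s => f (x - s)) volume a b := by
  have := (intervalIntegrable_of_locallyIntegrable hf (x - a) (x - b)).comp_sub_left x
  simpa using this

theorem measurable_steklovMean (hfm : Measurable f) : Measurable (steklovMean h f) := by
  unfold steklovMean
  refine Measurable.div_const ?_ _
  simp only [intervalIntegral]
  refine Measurable.sub ?_ ?_ <;>
  · refine (StronglyMeasurable.integral_prod_right'
      (f := fun z : ℝ × ℝ => (h - z.2) * (f (z.1 + z.2) + f (z.1 - z.2))) ?_).measurable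
    refine Measurable.stronglyMeasurable ?_
    fun_prop

/-- The triangular weight has mass one and is at most `1 / h`. -/
theorem abs_steklovMean_sub_le (hf : LocallyIntegrable f volume) (hh : 0 < h) (x : ℝ) :
    |steklovMean h f x - f x| ≤ h⁻¹ * ∫ s in Set.Ioc 0 h, |centralDiff s f x| := by
  have h1 := intervalIntegrable_comp_add hf x 0 h
  have h2 := intervalIntegrable_comp_sub hf x 0 h
  have hc : Continuous fun s : ℝ => h - s := by fun_prop
  have h3 : steklovMean h f x - f x =
      (∫ s in (0 : ℝ)..h, (h - s) * centralDiff s f x) / h ^ 2 := by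
    have h4 : ∫ s in (0 : ℝ)..h, (h - s) * (2 * f x) = f x * h ^ 2 := by
      rw [intervalIntegral.integral_mul_const, intervalIntegral.integral_sub (by simp) (by simp)]
      simp
      ring
    have h5 : ∀ s, (h - s) * centralDiff s f x =
        (h - s) * (f (x + s) + f (x - s)) - (h - s) * (2 * f x) := by
      intro s; unfold centralDiff; ring
    simp only [h5]
    rw [intervalIntegral.integral_sub ((h1.add h2).continuousOn_mul hc.continuousOn)
      (by apply Continuous.intervalIntegrable; fun_prop), h4]
    unfold steklovMean
    field_simp
  have h6 : IntervalIntegrable (fun s => centralDiff s f x) volume 0 h :=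
    (h1.sub (by simp)).add h2
  have h7 : |∫ s in (0 : ℝ)..h, (h - s) * centralDiff s f x| ≤
      h * ∫ s in (0 : ℝ)..h, |centralDiff s f x| := by
    rw [← intervalIntegral.integral_const_mul]
    refine intervalIntegral.norm_integral_le_of_norm_le (f := fun s => (h - s) * centralDiff s f x)
      hh.le (ae_of_all _ fun s hs => ?_) (h6.abs.const_mul h)
    rw [Real.norm_eq_abs, abs_mul, abs_of_nonneg (by linarith [hs.2])]
    exact mul_le_mul_of_nonneg_right (by linarith [hs.1]) (abs_nonneg _)
  rw [h3, abs_div, abs_of_pos (by positivity : 0 < h ^ 2), div_le_iff₀ (by positivity),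
    ← intervalIntegral.integral_of_le hh.le]
  refine h7.trans (le_of_eq ?_)
  field_simp

theorem measurable_centralDiff (hfm : Measurable f) :
    Measurable (Function.uncurry fun s x => centralDiff s f x) := by
  unfold centralDiff Function.uncurry
  fun_prop

theorem eLpNorm_steklovMean_sub_le (hfm : Measurable f) (hf : LocallyIntegrable f volume)
    (hh : 0 < h) {p : ℝ≥0∞} (hp : 1 ≤ p) {M : ℝ≥0∞}
    (hM : ∀ s ∈ Set.Ioc 0 h, eLpNorm (centralDiff s f) p volume ≤ M) :
    eLpNorm (fun x => steklovMean h f x - f x) p volume ≤ M := by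
  -- the uniform probability measure on `(0, h]`
  set μ : Measure ℝ := ENNReal.ofReal h⁻¹ • volume.restrict (Set.Ioc 0 h) with hμ
  have hμu : μ Set.univ = 1 := by
    rw [hμ, Measure.smul_apply, Measure.restrict_apply_univ, Real.volume_Ioc, sub_zero, smul_eq_mul,
      ← ENNReal.ofReal_mul (by positivity), inv_mul_cancel₀ hh.ne', ENNReal.ofReal_one]
  have : IsFiniteMeasure μ := ⟨by rw [hμu]; exact ENNReal.one_lt_top⟩
  have h1 := eLpNorm_lintegral_le μ volume (F := fun s x => ‖centralDiff s f x‖ₑ)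
    (measurable_centralDiff hfm).enorm hp (M := M) (by
      refine Measure.ae_smul_measure (ae_restrict_of_forall_mem measurableSet_Ioc fun s hs => ?_) _
      rw [eLpNorm_enorm (centralDiff s f)]
      exact hM s hs)
  rw [hμu, one_mul] at h1
  refine le_trans (eLpNorm_mono_enorm fun x => ?_) h1
  rw [enorm_eq_self, Real.enorm_eq_ofReal_abs]
  refine (ENNReal.ofReal_le_ofReal (abs_steklovMean_sub_le hf hh x)).trans ?_
  have h6 : Integrable (fun s => centralDiff s f x) (volume.restrict (Set.Ioc 0 h)) :=
    (((intervalIntegrable_comp_add hf x 0 h).sub (by simp)).add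
      (intervalIntegrable_comp_sub hf x 0 h)).1
  rw [ENNReal.ofReal_mul (by positivity), hμ, lintegral_smul_measure,
    ofReal_integral_eq_lintegral_ofReal h6.abs (ae_of_all _ fun _ => abs_nonneg _)]
  simp only [← Real.enorm_eq_ofReal_abs, smul_eq_mul]
  exact le_rfl

/-- The second antiderivative of `f` that vanishes to first order at the origin. -/
noncomputable def secondPrimitive (f : ℝ → ℝ) (x : ℝ) : ℝ := ∫ v in (0 : ℝ)..x, (x - v) * f v

/-- Taylor's formula with integral remainder; no differentiation is needed, since the integrand
`(u - v) f v` is affine in `u`. -/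
theorem secondPrimitive_sub (hf : LocallyIntegrable f volume) (x u : ℝ) :
    secondPrimitive f u - secondPrimitive f x =
      (u - x) * (∫ v in (0 : ℝ)..x, f v) + ∫ v in x..u, (u - v) * f v := by
  unfold secondPrimitive
  have hi : ∀ c a b : ℝ, IntervalIntegrable (fun v => (c - v) * f v) volume a b := fun c a b =>
    intervalIntegrable_mul hf (by fun_prop) a b
  rw [← intervalIntegral.integral_add_adjacent_intervals (hi u 0 x) (hi u x u),
    ← intervalIntegral.integral_const_mul, add_sub_right_comm,
    ← intervalIntegral.integral_sub (hi u 0 x) (hi x 0 x)]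
  congr 2
  ext v
  ring

theorem steklovMean_eq_secondPrimitive (hf : LocallyIntegrable f volume) (x : ℝ) :
    steklovMean h f x = centralDiff h (secondPrimitive f) x / h ^ 2 := by
  have h1 := secondPrimitive_sub hf x (x + h)
  have h2 := secondPrimitive_sub hf x (x - h)
  have h3 : ∫ v in x..x + h, (x + h - v) * f v = ∫ s in (0 : ℝ)..h, (h - s) * f (x + s) := by
    have := intervalIntegral.integral_comp_add_left (a := 0) (b := h)
      (fun v => (x + h - v) * f v) x
    rw [add_zero] at this
    rw [← this]
    congr 1
    ext s
    ring
  have h4 : ∫ v in x..x - h, (x - h - v) * f v = ∫ s in (0 : ℝ)..h, (h - s) * f (x - s) := by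
    have := intervalIntegral.integral_comp_sub_left (a := 0) (b := h)
      (fun v => (x - h - v) * f v) x
    rw [sub_zero] at this
    rw [intervalIntegral.integral_symm, ← this, ← intervalIntegral.integral_neg]
    congr 1
    ext s
    ring
  have hc : Continuous fun s : ℝ => h - s := by fun_prop
  unfold steklovMean
  simp only [mul_add]
  rw [intervalIntegral.integral_add
    ((intervalIntegrable_comp_add hf x 0 h).continuousOn_mul hc.continuousOn)
    ((intervalIntegrable_comp_sub hf x 0 h).continuousOn_mul hc.continuousOn), ← h3, ← h4]
  congr 1
  unfold centralDiff
  linarith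

/-- Taylor's formula for the Steklov mean, whose second derivative is `centralDiff h f / h ^ 2`. -/
theorem exists_steklovMean_taylor (hf : LocallyIntegrable f volume) (x : ℝ) :
    ∃ b : ℝ, ∀ u, steklovMean h f u - (steklovMean h f x + b * (u - x)) =
      (∫ v in x..u, (u - v) * centralDiff h f v) / h ^ 2 := by
  refine ⟨centralDiff h (fun y => ∫ v in (0 : ℝ)..y, f v) x / h ^ 2, fun u => ?_⟩
  have h1 := secondPrimitive_sub hf x u
  have h2 := secondPrimitive_sub hf (x + h) (u + h)
  have h3 := secondPrimitive_sub hf (x - h) (u - h)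
  have h4 : ∫ v in (x + h)..(u + h), (u + h - v) * f v = ∫ v in x..u, (u - v) * f (h + v) := by
    rw [← intervalIntegral.integral_comp_add_right]
    congr 1
    ext v
    rw [add_comm v h]
    ring
  have h5 : ∫ v in (x - h)..(u - h), (u - h - v) * f v = ∫ v in x..u, (u - v) * f (-h + v) := by
    rw [← intervalIntegral.integral_comp_sub_right]
    congr 1
    ext v
    rw [neg_add_eq_sub]
    ring
  have hc : Continuous fun v : ℝ => u - v := by fun_prop
  have i1 := (intervalIntegrable_comp_add hf h x u).continuousOn_mul
    (g := fun v : ℝ => u - v) hc.continuousOn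
  have i2 := (intervalIntegrable_comp_add hf (-h) x u).continuousOn_mul
    (g := fun v : ℝ => u - v) hc.continuousOn
  have i3 := intervalIntegrable_mul hf hc x u
  have h6 : ∫ v in x..u, (u - v) * centralDiff h f v =
      (∫ v in x..u, (u - v) * f (h + v)) - 2 * (∫ v in x..u, (u - v) * f v) +
        ∫ v in x..u, (u - v) * f (-h + v) := by
    rw [← intervalIntegral.integral_const_mul, ← intervalIntegral.integral_sub i1 (i3.const_mul 2),
      ← intervalIntegral.integral_add (i1.sub (i3.const_mul 2)) i2]
    congr 1
    ext v
    unfold centralDiff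
    rw [add_comm v h, neg_add_eq_sub]
    ring
  rw [steklovMean_eq_secondPrimitive hf, steklovMean_eq_secondPrimitive hf, h6, ← h4, ← h5]
  unfold centralDiff
  rw [div_mul_eq_mul_div, ← add_div, ← sub_div]
  congr 1
  linear_combination h2 - 2 * h1 + h3

/-- The error of the Durrmeyer operator on a Steklov mean whose step matches the sampling rate. -/
theorem eLpNorm_durrmeyer_steklovMean_sub_le {n : ℕ} (hn : 2 ≤ n) (hfm : Measurable f)
    {p : ℝ≥0∞} (hp : 1 ≤ p) (hf : LocallyIntegrable f volume) {w : ℝ} (hw : 0 < w)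
    (hg : LocallyIntegrable (steklovMean w⁻¹ f) volume)
    (hd : LocallyIntegrable (centralDiff w⁻¹ f) volume) :
    eLpNorm (fun x => durrmeyer (centralBSpline n) (centralBSpline n) w (steklovMean w⁻¹ f) x -
      steklovMean w⁻¹ f x) p volume ≤
      ENNReal.ofReal (4 * n ^ 3) * eLpNorm (centralDiff w⁻¹ f) p volume := by
  set g := steklovMean w⁻¹ f with hgdef
  set q := centralDiff w⁻¹ f with hq
  have hqm : Measurable q := (measurable_centralDiff hfm).of_uncurry_left
  set a : ℝ := n / w with ha
  have ha0 : 0 ≤ a := by positivity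
  have h1 : ∀ x, ‖durrmeyer (centralBSpline n) (centralBSpline n) w g x - g x‖ ≤
      (2 * n ^ 2 * w) * ∫ v in Set.Icc (x - a) (x + a), |q v| := by
    intro x
    obtain ⟨b, hb⟩ := exists_steklovMean_taylor (h := w⁻¹) hf x
    have hbl : LocallyIntegrable (fun u => g x + b * (u - x)) volume :=
      Continuous.locallyIntegrable (by fun_prop)
    -- the error at `x` is the operator applied to the first order Taylor remainder of `g` at `x`
    have h2 := durrmeyer_sub hn hw hg hbl x
    rw [durrmeyer_affine hn hw, sub_self, mul_zero, add_zero] at h2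
    rw [← h2]
    refine (abs_durrmeyer_le hn hw (hg.sub hbl) x).trans ?_
    set R := ∫ v in Set.Icc (x - a) (x + a), |q v| with hR
    have h3 : ∀ u ∈ Set.Icc (x - a) (x + a), |g u - (g x + b * (u - x))| ≤ a * w ^ 2 * R := by
      intro u hu
      rw [hb u, abs_div, abs_of_nonneg (by positivity : (0 : ℝ) ≤ w⁻¹ ^ 2), inv_pow, div_inv_eq_mul]
      have h4 : |∫ v in x..u, (u - v) * q v| ≤ a * R := by
        have hxu : Set.uIoc x u ⊆ Set.Icc (x - a) (x + a) := by
          refine Set.uIoc_subset_uIcc.trans (Set.uIcc_subset_Icc ⟨?_, ?_⟩ hu) <;> linarith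
        refine (intervalIntegral.norm_integral_le_integral_norm_uIoc
          (f := fun v => (u - v) * q v)).trans ?_
        rw [hR, ← integral_const_mul]
        have hi : IntegrableOn (fun v => a * |q v|) (Set.Icc (x - a) (x + a)) :=
          (hd.integrableOn_isCompact isCompact_Icc).abs.const_mul a
        refine (integral_mono_of_nonneg (ae_of_all _ fun _ => norm_nonneg _) (hi.mono_set hxu)
          ?_).trans (setIntegral_mono_set hi (ae_of_all _ fun _ => by positivity)
            hxu.eventuallyLE)
        refine ae_restrict_of_forall_mem measurableSet_uIoc fun v hv => ?_
        simp only [norm_mul, Real.norm_eq_abs]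
        refine mul_le_mul_of_nonneg_right ?_ (abs_nonneg _)
        refine (Set.abs_sub_right_of_mem_uIcc (Set.uIoc_subset_uIcc hv)).trans ?_
        exact abs_le.2 ⟨by linarith [hu.1], by linarith [hu.2]⟩
      nlinarith [sq_nonneg w]
    have h6 : ∫ u in Set.Icc (x - a) (x + a), |g u - (g x + b * (u - x))| ≤
        (a * w ^ 2 * R) * (2 * a) := by
      have h7 := norm_setIntegral_le_of_norm_le_const (μ := volume)
        (s := Set.Icc (x - a) (x + a)) (f := fun u => |g u - (g x + b * (u - x))|)
        (C := a * w ^ 2 * R) (by simp) (fun u hu => by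
          rw [Real.norm_eq_abs, abs_abs]; exact h3 u hu)
      rw [Real.volume_real_Icc_of_le (by linarith)] at h7
      refine (le_abs_self _).trans (h7.trans (le_of_eq ?_))
      ring
    refine (mul_le_mul_of_nonneg_left h6 hw.le).trans (le_of_eq ?_)
    rw [ha]
    field_simp
  refine (eLpNorm_mono_real h1).trans ?_
  have h2 := eLpNorm_integral_Icc_abs_le hqm hd hp a
  have h3 := eLpNorm_const_smul (2 * n ^ 2 * w)
    (fun x => ∫ u in Set.Icc (x - a) (x + a), |q u|) p volume
  simp only [Pi.smul_def, smul_eq_mul] at h3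
  rw [h3, Real.enorm_of_nonneg (by positivity)]
  refine (mul_le_mul_right h2 _).trans (le_of_eq ?_)
  rw [← mul_assoc, ← ENNReal.ofReal_mul (by positivity)]
  congr 2
  rw [ha]
  field_simp
  ring

/-- The direct estimate: the error of the Durrmeyer operator is controlled by second differences
with steps up to `1 / w`. -/
theorem eLpNorm_durrmeyer_sub_le {n : ℕ} (hn : 2 ≤ n) (hfm : Measurable f)
    {p : ℝ≥0∞} (hp : 1 ≤ p) (hf : MemLp f p volume) {w : ℝ} (hw : 0 < w) {M : ℝ≥0∞} (hMt : M ≠ ∞)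
    (hM : ∀ s ∈ Set.Ioc 0 w⁻¹, eLpNorm (centralDiff s f) p volume ≤ M) :
    eLpNorm (fun x => durrmeyer (centralBSpline n) (centralBSpline n) w f x - f x) p volume ≤
      ENNReal.ofReal (4 * n ^ 3 + 2 * n + 1) * M := by
  have hloc := hf.locallyIntegrable hp
  have hw' : 0 < w⁻¹ := inv_pos.2 hw
  set g := steklovMean w⁻¹ f with hg
  set D := durrmeyer (centralBSpline n) (centralBSpline n) w with hD
  have hgm : Measurable g := measurable_steklovMean hfm
  have h1 : eLpNorm (fun x => g x - f x) p volume ≤ M :=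
    eLpNorm_steklovMean_sub_le hfm hloc hw' hp hM
  have hgf : MemLp (fun x => g x - f x) p volume :=
    ⟨(hgm.sub hfm).aestronglyMeasurable, h1.trans_lt hMt.lt_top⟩
  have hgL : MemLp g p volume := by
    have := hgf.add hf
    refine this.congr_norm hgm.aestronglyMeasurable (ae_of_all _ fun x => by simp)
  have hdM : MemLp (centralDiff w⁻¹ f) p volume :=
    ⟨(measurable_centralDiff hfm).of_uncurry_left.aestronglyMeasurable,
      (hM _ ⟨hw', le_rfl⟩).trans_lt hMt.lt_top⟩
  have h2 := eLpNorm_durrmeyer_steklovMean_sub_le hn hfm hp hloc hw (hgL.locallyIntegrable hp)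
    (hdM.locallyIntegrable hp)
  have h3 := eLpNorm_durrmeyer_le hn hw (hgm.sub hfm) hp hgf
  have h4 : (fun x => D f x - f x) =
      (fun x => D g x - g x) + ((fun x => g x - f x) - D (fun x => g x - f x)) := by
    ext x
    have := durrmeyer_sub hn hw (hgL.locallyIntegrable hp) hloc x
    simp only [Pi.add_apply, Pi.sub_apply, hD] at this ⊢
    rw [this]
    ring
  have m1 : AEStronglyMeasurable (fun x => D g x - g x) volume :=
    ((measurable_durrmeyer hn).sub hgm).aestronglyMeasurable
  have m2 : AEStronglyMeasurable (D fun x => g x - f x) volume :=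
    (measurable_durrmeyer hn).aestronglyMeasurable
  rw [h4]
  calc _ ≤ eLpNorm (fun x => D g x - g x) p volume +
        (eLpNorm (fun x => g x - f x) p volume + eLpNorm (D fun x => g x - f x) p volume) :=
        (eLpNorm_add_le m1 (hgf.1.sub m2) hp).trans
          (add_le_add le_rfl (eLpNorm_sub_le hgf.1 m2 hp))
    _ ≤ ENNReal.ofReal (4 * n ^ 3) * M + (M + ENNReal.ofReal (2 * n) * M) := by
        refine add_le_add (h2.trans (mul_le_mul_right (hM _ ⟨hw', le_rfl⟩) _))
          (add_le_add h1 (h3.trans (mul_le_mul_right h1 _)))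
    _ = ENNReal.ofReal (4 * n ^ 3 + 2 * n + 1) * M := by
        rw [ENNReal.ofReal_add (by positivity) (by positivity),
          ENNReal.ofReal_add (by positivity) (by positivity), ENNReal.ofReal_one]
        ring

end Steklov

/-! ### Iterated Durrmeyer operators and spline correlations -/

/-- The correlation of the central B-spline with its integer translate by `i`. -/
noncomputable def splineCorrelation (n : ℕ) (i : ℤ) : ℝ :=
  ∫ u, centralBSpline n u * centralBSpline n (u - i)

section Correlation

variable {n : ℕ}

theorem integrable_centralBSpline_mul_translate (hn : 2 ≤ n) (i : ℤ) :
    Integrable fun u => centralBSpline n u * centralBSpline n (u - i) := by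
  have hc := continuous_centralBSpline n
  have := integrable_centralBSpline_mul (f := fun u => centralBSpline n (u - i)) hn one_pos
    (Continuous.locallyIntegrable (by fun_prop)) 0
  simpa using this

theorem splineCorrelation_nonneg (hn : 2 ≤ n) (i : ℤ) : 0 ≤ splineCorrelation n i :=
  integral_nonneg fun _ => mul_nonneg (centralBSpline_nonneg hn _) (centralBSpline_nonneg hn _)

theorem splineCorrelation_one_pos (hn : 2 ≤ n) : 0 < splineCorrelation n 1 := by
  have hc := continuous_centralBSpline n
  have hn2 : (2 : ℝ) ≤ n := by exact_mod_cast hn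
  refine Continuous.integral_pos_of_hasCompactSupport_nonneg_nonzero
    (f := fun u => centralBSpline n u * centralBSpline n (u - (1 : ℤ))) (x := 1 / 2) (by fun_prop)
    (hasCompactSupport_centralBSpline hn).mul_right
    (fun u => mul_nonneg (centralBSpline_nonneg hn _) (centralBSpline_nonneg hn _)) ?_
  refine (mul_pos (centralBSpline_pos hn ?_) (centralBSpline_pos hn ?_)).ne' <;>
    norm_num [abs_lt] <;> linarith

/-- On the support of the central B-spline, only the translates by `-n, …, n` matter. -/
theorem centralBSpline_mul_tsum_translates (hn : 2 ≤ n) (v : ℝ) (c : ℤ → ℝ) :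
    centralBSpline n v * ∑' i : ℤ, centralBSpline n (v - i) * c i =
      ∑ j ∈ Finset.range (2 * n + 1),
        centralBSpline n v * centralBSpline n (v - ((j - n : ℤ) : ℝ)) * c (j - n) := by
  by_cases hv : centralBSpline n v = 0
  · simp [hv]
  have hv' : |v| < (n : ℝ) / 2 := by
    by_contra h
    exact hv (centralBSpline_eq_zero hn (not_lt.1 h))
  have hinj : Function.Injective fun j : ℕ => (j - n : ℤ) := by
    intro a b hab
    simp only at hab
    omega
  rw [tsum_eq_sum (s := (Finset.range (2 * n + 1)).map ⟨_, hinj⟩), Finset.sum_map, Finset.mul_sum]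
  · simp only [Function.Embedding.coeFn_mk, mul_assoc]
  · intro i hi
    rw [centralBSpline_eq_zero hn, zero_mul]
    by_contra h
    have h1 := abs_lt.1 hv'
    have h2 := abs_lt.1 (not_le.1 h)
    have h3 : ((-n : ℤ) : ℝ) < (i : ℝ) := by push_cast; linarith
    have h4 : (i : ℝ) < ((n : ℤ) : ℝ) := by push_cast; linarith
    have h5 : -(n : ℤ) < i := by exact_mod_cast h3
    have h6 : i < (n : ℤ) := by exact_mod_cast h4
    refine hi (Finset.mem_map.2 ⟨(i + n).toNat, Finset.mem_range.2 (by omega), ?_⟩)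
    simp only [Function.Embedding.coeFn_mk]
    omega

theorem sum_splineCorrelation (hn : 2 ≤ n) :
    ∑ j ∈ Finset.range (2 * n + 1), splineCorrelation n (j - n) = 1 := by
  unfold splineCorrelation
  rw [← integral_finsetSum _ fun j _ => integrable_centralBSpline_mul_translate hn _,
    ← integral_centralBSpline hn]
  congr 1
  ext v
  have h := centralBSpline_mul_tsum_translates hn v fun _ => 1
  simp only [mul_one, tsum_centralBSpline hn] at h
  exact h.symm

/-- The Durrmeyer operator acts on its own range as a discrete convolution with the spline
correlations. -/
theorem durrmeyer_durrmeyer (hn : 2 ≤ n) {w : ℝ} (hw : 0 < w) (f : ℝ → ℝ) (x : ℝ) :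
    durrmeyer (centralBSpline n) (centralBSpline n) w
        (durrmeyer (centralBSpline n) (centralBSpline n) w f) x =
      ∑ j ∈ Finset.range (2 * n + 1), splineCorrelation n (j - n) *
        durrmeyer (centralBSpline n) (centralBSpline n) w f (x + (j - n) * w⁻¹) := by
  have hc := continuous_centralBSpline n
  set c : ℤ → ℝ := fun k => w * ∫ u, centralBSpline n (w * u - k) * f u with hcdef
  have hD : ∀ y, durrmeyer (centralBSpline n) (centralBSpline n) w f y =
      ∑' k : ℤ, centralBSpline n (w * y - k) * c k := fun y => rfl
  have hshift : ∀ (y : ℝ) (k : ℤ), ∑' m : ℤ, centralBSpline n (y - m) * c m =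
      ∑' i : ℤ, centralBSpline n (y - k - i) * c (k + i) := by
    intro y k
    rw [← (Equiv.addLeft k).tsum_eq]
    simp [sub_sub]
  have h1 : ∀ (k : ℤ) (u : ℝ), centralBSpline n (w * u - k) *
      durrmeyer (centralBSpline n) (centralBSpline n) w f u =
      ∑ j ∈ Finset.range (2 * n + 1), (fun v => centralBSpline n v *
        centralBSpline n (v - ((j - n : ℤ) : ℝ)) * c (k + (j - n))) (w * u - k) := by
    intro k u
    rw [hD, hshift _ k, centralBSpline_mul_tsum_translates hn _ fun i => c (k + i)]
  have h2 : ∀ k : ℤ, w * ∫ u, centralBSpline n (w * u - k) *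
      durrmeyer (centralBSpline n) (centralBSpline n) w f u =
      ∑ j ∈ Finset.range (2 * n + 1), splineCorrelation n (j - n) * c (k + (j - n)) := by
    intro k
    simp only [h1]
    rw [mul_integral_comp_mul_sub (fun v => ∑ j ∈ Finset.range (2 * n + 1), centralBSpline n v *
      centralBSpline n (v - ((j - n : ℤ) : ℝ)) * c (k + (j - n))) hw k,
      integral_finsetSum _ fun j _ =>
        (integrable_centralBSpline_mul_translate hn _).mul_const _]
    simp only [integral_mul_const]
    rfl
  have h3 : durrmeyer (centralBSpline n) (centralBSpline n) w
      (durrmeyer (centralBSpline n) (centralBSpline n) w f) x =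
      ∑' k : ℤ, ∑ j ∈ Finset.range (2 * n + 1),
        splineCorrelation n (j - n) * (centralBSpline n (w * x - k) * c (k + (j - n))) := by
    rw [durrmeyer]
    refine tsum_congr fun k => ?_
    rw [h2, Finset.mul_sum]
    exact Finset.sum_congr rfl fun j _ => by ring
  have h4 : ∀ j ∈ Finset.range (2 * n + 1), Summable fun k : ℤ =>
      splineCorrelation n (j - n) * (centralBSpline n (w * x - k) * c (k + (j - n))) :=
    fun j _ => (summable_centralBSpline_mul hn (w * x) _).mul_left _
  rw [h3, Summable.tsum_finsetSum h4]
  refine Finset.sum_congr rfl fun j _ => ?_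
  rw [tsum_mul_left, hD, hshift _ (j - n)]
  congr 1
  refine tsum_congr fun k => ?_
  rw [add_comm k]
  congr 2
  push_cast
  field_simp
  ring

end Correlation

/-! ### Polynomials in a translation -/

section Symbol

open Polynomial

variable {n m : ℕ} {β : ℕ → ℝ}

/-- If `β` is a probability vector on `{0, …, m - 1}` charging `n + 1`, then `1` is the only zero
of `X ^ n - ∑ β j X ^ j` on the unit circle. -/
theorem eq_one_of_pow_eq_sum (hβ : ∀ j, 0 ≤ β j) (hsum : ∑ j ∈ Finset.range m, β j = 1)
    (hm : n + 1 < m) (hpos : 0 < β (n + 1)) {z : ℂ} (hz : ‖z‖ = 1)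
    (h : z ^ n = ∑ j ∈ Finset.range m, (β j : ℂ) * z ^ j) : z = 1 := by
  -- comparing real parts after division by `z ^ n`, where `z⁻¹` is the conjugate
  have hzz : z * (starRingEnd ℂ) z = 1 := by
    rw [Complex.mul_conj, Complex.normSq_eq_norm_sq, hz]; simp
  have h1 : ∑ j ∈ Finset.range m, β j * (1 - (z ^ j * (starRingEnd ℂ) z ^ n).re) = 0 := by
    have h2 : (1 : ℂ) = ∑ j ∈ Finset.range m, (β j : ℂ) * (z ^ j * (starRingEnd ℂ) z ^ n) := by
      simp only [← mul_assoc]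
      rw [← Finset.sum_mul, ← h, ← mul_pow, hzz, one_pow]
    have h3 := congrArg Complex.re h2
    simp only [Complex.re_sum, Complex.re_ofReal_mul, Complex.one_re] at h3
    simp only [mul_sub, mul_one, Finset.sum_sub_distrib]
    rw [hsum, ← h3, sub_self]
  have h4 : ∀ j ∈ Finset.range m, 0 ≤ β j * (1 - (z ^ j * (starRingEnd ℂ) z ^ n).re) := by
    intro j _
    refine mul_nonneg (hβ j) (sub_nonneg.2 ((Complex.re_le_norm _).trans (le_of_eq ?_)))
    simp [hz]
  have h5 := (Finset.sum_eq_zero_iff_of_nonneg h4).1 h1 (n + 1) (Finset.mem_range.2 hm)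
  rw [pow_succ', mul_assoc, ← mul_pow, hzz, one_pow, mul_one] at h5
  have h6 : z.re = 1 := by
    rcases mul_eq_zero.1 h5 with h7 | h7 <;> linarith
  have h8 : z.im = 0 := by
    have := Complex.sq_norm z
    rw [hz, Complex.normSq_apply, h6] at this
    nlinarith
  exact Complex.ext (by simp [h6]) (by simp [h8])

/-- The zero at `1` has multiplicity at most two, since the second moment of `β` about `n` does
not vanish. -/
theorem not_X_sub_one_pow_three_dvd (hβ : ∀ j, 0 ≤ β j) (hsum : ∑ j ∈ Finset.range m, β j = 1)
    (hm : n + 1 < m) (hpos : 0 < β (n + 1)) :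
    ¬ (X - C 1 : ℂ[X]) ^ 3 ∣ X ^ n - ∑ j ∈ Finset.range m, C (β j : ℂ) * X ^ j := by
  rintro ⟨R, hR⟩
  have e1 : ∀ j : ℕ, (derivative (X ^ j : ℂ[X])).eval 1 = j := by
    simp [derivative_X_pow]
  have e2 : ∀ j : ℕ, (derivative (derivative (X ^ j : ℂ[X]))).eval 1 = (j : ℂ) ^ 2 - j := by
    intro j
    cases j with
    | zero => simp
    | succ j => simp [derivative_X_pow]; ring
  have d1 := congrArg (fun q : ℂ[X] => (derivative q).eval 1) hR
  have d2 := congrArg (fun q : ℂ[X] => (derivative (derivative q)).eval 1) hR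
  simp only [derivative_sub, derivative_sum, derivative_C_mul, eval_sub, eval_finsetSum, eval_mul,
    eval_C, e1, e2] at d1 d2
  simp [derivative_pow] at d1 d2
  have d1' : (n : ℝ) - ∑ j ∈ Finset.range m, β j * j = 0 := by exact_mod_cast d1
  have d2' : (n : ℝ) ^ 2 - n - ∑ j ∈ Finset.range m, β j * ((j : ℝ) ^ 2 - j) = 0 := by
    exact_mod_cast d2
  -- a triple zero makes the first two moments those of the point mass at `n`
  have h0 : ∑ j ∈ Finset.range m, β j * ((j : ℝ) - n) ^ 2 = 0 := by
    have : ∀ j : ℕ, β j * ((j : ℝ) - n) ^ 2 =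
        β j * ((j : ℝ) ^ 2 - j) + (1 - 2 * n) * (β j * j) + n ^ 2 * β j := fun j => by ring
    simp only [this, Finset.sum_add_distrib, ← Finset.mul_sum, hsum]
    linear_combination -d2' - (1 - 2 * (n : ℝ)) * d1'
  have h1 := (Finset.sum_eq_zero_iff_of_nonneg fun j _ =>
    mul_nonneg (hβ j) (sq_nonneg ((j : ℝ) - n))).1 h0 (n + 1) (Finset.mem_range.2 hm)
  simp [hpos.ne'] at h1

/-- The symbol `X ^ n - ∑ β j X ^ j` is, up to a factor without zeros on the unit circle, a power
of `X - 1` with exponent at most two. -/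
theorem exists_symbol_factorization (hβ : ∀ j, 0 ≤ β j) (hsum : ∑ j ∈ Finset.range m, β j = 1)
    (hm : n + 1 < m) (hpos : 0 < β (n + 1)) :
    ∃ (k : ℕ) (Q : ℂ[X]), k ≤ 2 ∧
      X ^ n - ∑ j ∈ Finset.range m, C (β j : ℂ) * X ^ j = Q * (X - C 1) ^ k ∧
      ∀ z : ℂ, ‖z‖ = 1 → Q.eval z ≠ 0 := by
  set P : ℂ[X] := X ^ n - ∑ j ∈ Finset.range m, C (β j : ℂ) * X ^ j with hP
  have h3 := not_X_sub_one_pow_three_dvd hβ hsum hm hpos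
  have hP0 : P ≠ 0 := fun h => h3 (by rw [← hP, h]; exact dvd_zero _)
  obtain ⟨Q, hQ, hdvd⟩ := P.exists_eq_pow_rootMultiplicity_mul_and_not_dvd hP0 1
  refine ⟨P.rootMultiplicity 1, Q, ?_, by rw [mul_comm]; exact hQ, fun z hz h0 => ?_⟩
  · by_contra h
    exact h3 ((pow_dvd_pow _ (by omega)).trans ⟨Q, hQ⟩)
  · have h4 : P.eval z = 0 := by rw [hQ, eval_mul, h0, mul_zero]
    simp only [hP, eval_sub, eval_pow, eval_X, eval_finsetSum, eval_mul, eval_C] at h4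
    have h5 := eq_one_of_pow_eq_sum hβ hsum hm hpos hz (sub_eq_zero.1 h4)
    rw [h5] at h0
    exact hdvd (dvd_iff_isRoot.2 h0)

/-- The translation operator `(T φ)(x) = φ (x + a)` on complex functions. -/
def translation (a : ℝ) : (ℝ → ℂ) →ₗ[ℂ] (ℝ → ℂ) := LinearMap.funLeft ℂ ℂ fun x => x + a

theorem translation_apply (a : ℝ) (φ : ℝ → ℂ) (x : ℝ) : translation a φ x = φ (x + a) := rfl

theorem translation_pow_apply (a : ℝ) (j : ℕ) (φ : ℝ → ℂ) (x : ℝ) :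
    (translation a ^ j) φ x = φ (x + j * a) := by
  induction j generalizing x with
  | zero => simp
  | succ j ih =>
    rw [pow_succ', Module.End.mul_apply, translation_apply, ih]
    congr 1
    push_cast
    ring

variable {p : ℝ≥0∞} {φ : ℝ → ℂ}

theorem memLp_translation (hφ : MemLp φ p volume) (a : ℝ) :
    MemLp (translation a φ) p volume :=
  hφ.comp_measurePreserving (measurePreserving_add_right volume a)

theorem eLpNorm_translation (hφ : MemLp φ p volume) (a : ℝ) :
    eLpNorm (translation a φ) p volume = eLpNorm φ p volume :=
  eLpNorm_comp_add_right hφ.1 p a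

theorem memLp_aeval_translation (hφ : MemLp φ p volume) (a : ℝ) (Q : ℂ[X]) :
    MemLp (aeval (translation a) Q φ) p volume := by
  induction Q using Polynomial.induction_on' with
  | add P Q hP hQ =>
    rw [map_add, LinearMap.add_apply]
    exact hP.add hQ
  | monomial j c =>
    rw [aeval_monomial, Module.End.mul_apply, Module.algebraMap_end_apply]
    refine MemLp.const_smul ?_ c
    induction j with
    | zero => simpa using hφ
    | succ j ih =>
      rw [pow_succ', Module.End.mul_apply]
      exact memLp_translation ih a

theorem aeval_translation_X_sub_C (a : ℝ) (z : ℂ) (φ : ℝ → ℂ) :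
    aeval (translation a) (X - C z) φ = translation a φ - z • φ := by
  simp [Module.algebraMap_end_apply]

/-- A translation preserves the norm, so subtracting `z` leaves at least the fraction `|‖z‖ - 1|`
of it. -/
theorem eLpNorm_aeval_X_sub_C_ge (hp : 1 ≤ p) (hφ : MemLp φ p volume) (a : ℝ) (z : ℂ) :
    ENNReal.ofReal |‖z‖ - 1| * eLpNorm φ p volume ≤
      eLpNorm (aeval (translation a) (X - C z) φ) p volume := by
  have hE := memLp_aeval_translation hφ a (X - C z)
  rw [aeval_translation_X_sub_C] at hE ⊢
  have hT := memLp_translation hφ a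
  have hz := hφ.const_smul z
  have hzn := eLpNorm_const_smul z φ p volume
  have h1 : eLpNorm φ p volume ≤
      eLpNorm (translation a φ - z • φ) p volume + ‖z‖ₑ * eLpNorm φ p volume := by
    rw [← hzn]
    nth_rw 1 [← eLpNorm_translation hφ a]
    have := eLpNorm_add_le hE.1 hz.1 hp
    rwa [sub_add_cancel] at this
  have h2 : ‖z‖ₑ * eLpNorm φ p volume ≤
      eLpNorm (translation a φ - z • φ) p volume + eLpNorm φ p volume := by
    rw [← hzn]
    rw [← eLpNorm_translation hφ a]
    have := eLpNorm_sub_le hT.1 hE.1 hp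
    rw [sub_sub_cancel] at this
    rwa [add_comm] at this
  have hN := hφ.2.ne
  have hE' := hE.2.ne
  rw [← ofReal_norm] at h1 h2
  generalize eLpNorm φ p volume = N at *
  generalize eLpNorm (translation a φ - z • φ) p volume = E at *
  lift N to NNReal using hN
  lift E to NNReal using hE'
  have e1 : ENNReal.ofReal ‖z‖ = ((‖z‖₊ : NNReal) : ℝ≥0∞) := ofReal_norm z
  have e2 : ENNReal.ofReal |‖z‖ - 1| = ((Real.toNNReal |‖z‖ - 1| : NNReal) : ℝ≥0∞) := rfl
  rw [e1] at h1 h2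
  rw [e2]
  norm_cast at h1 h2 ⊢
  rw [← NNReal.coe_le_coe] at h1 h2 ⊢
  push_cast at h1 h2 ⊢
  rw [Real.coe_toNNReal _ (abs_nonneg _)]
  rcases abs_cases (‖z‖ - 1) with ⟨h, _⟩ | ⟨h, _⟩ <;> rw [h] <;> nlinarith

/-- A polynomial without zeros on the unit circle is bounded below on `L^p` when evaluated at a
translation: each linear factor is, because translations are isometries. -/
theorem exists_le_eLpNorm_aeval_translation (hp : 1 ≤ p) (Q : ℂ[X])
    (hQ : ∀ z : ℂ, ‖z‖ = 1 → Q.eval z ≠ 0) :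
    ∃ c : ℝ, 0 < c ∧ ∀ (a : ℝ) (φ : ℝ → ℂ), MemLp φ p volume →
      ENNReal.ofReal c * eLpNorm φ p volume ≤ eLpNorm (aeval (translation a) Q φ) p volume := by
  have hQ0 : Q ≠ 0 := by
    rintro rfl
    exact hQ 1 (by simp) (by simp)
  have hs : ∀ s : Multiset ℂ, (∀ z ∈ s, ‖z‖ ≠ 1) →
      ∃ c : ℝ, 0 < c ∧ ∀ (a : ℝ) (φ : ℝ → ℂ), MemLp φ p volume →
        ENNReal.ofReal c * eLpNorm φ p volume ≤
          eLpNorm (aeval (translation a) (s.map fun z => X - C z).prod φ) p volume := by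
    intro s
    induction s using Multiset.induction with
    | empty => exact fun _ => ⟨1, one_pos, fun a φ _ => by simp⟩
    | cons z s ih =>
      intro hz
      obtain ⟨c, hc, h⟩ := ih fun y hy => hz y (Multiset.mem_cons_of_mem hy)
      have hz1 : 0 < |‖z‖ - 1| := abs_pos.2 (sub_ne_zero.2 (hz z (Multiset.mem_cons_self _ _)))
      refine ⟨|‖z‖ - 1| * c, by positivity, fun a φ hφ => ?_⟩
      rw [Multiset.map_cons, Multiset.prod_cons, map_mul, Module.End.mul_apply,
        ENNReal.ofReal_mul hz1.le, mul_assoc]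
      exact (mul_le_mul_right (h a φ hφ) _).trans
        (eLpNorm_aeval_X_sub_C_ge hp (memLp_aeval_translation hφ a _) a z)
  obtain ⟨c, hc, h⟩ := hs Q.roots fun z hz h1 => hQ z h1 (isRoot_of_mem_roots hz)
  have hl : 0 < ‖Q.leadingCoeff‖ := norm_pos_iff.2 (leadingCoeff_ne_zero.2 hQ0)
  refine ⟨‖Q.leadingCoeff‖ * c, by positivity, fun a φ hφ => ?_⟩
  have hsplit := (IsAlgClosed.splits Q).eq_prod_roots
  have h2 : eLpNorm (aeval (translation a) Q φ) p volume = ‖Q.leadingCoeff‖ₑ *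
      eLpNorm (aeval (translation a) (Q.roots.map fun z => X - C z).prod φ) p volume := by
    conv_lhs => rw [hsplit, map_mul, aeval_C, Module.End.mul_apply, Module.algebraMap_end_apply,
      eLpNorm_const_smul]
  rw [h2, ENNReal.ofReal_mul hl.le, mul_assoc, ofReal_norm]
  exact mul_le_mul_right (h a φ hφ) _

end Symbol

/-! ### Finite differences -/

section FiniteDiff

variable {f g : ℝ → ℝ} {p : ℝ≥0∞} {t : ℝ}

theorem finiteDiff_one (t : ℝ) (f : ℝ → ℝ) (x : ℝ) :
    finiteDiff 1 t f x = f (x + t) - f x := by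
  simp [finiteDiff, Finset.sum_range_succ]
  ring

theorem finiteDiff_two (t : ℝ) (f : ℝ → ℝ) (x : ℝ) :
    finiteDiff 2 t f x = f (x + 2 * t) - 2 * f (x + t) + f x := by
  simp [finiteDiff, Finset.sum_range_succ]
  ring

theorem finiteDiff_two_eq (t : ℝ) (f : ℝ → ℝ) :
    finiteDiff 2 t f = finiteDiff 1 t (finiteDiff 1 t f) := by
  ext x
  simp only [finiteDiff_one, finiteDiff_two]
  rw [show x + t + t = x + 2 * t by ring]
  ring

theorem centralDiff_eq (t : ℝ) (f : ℝ → ℝ) :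
    centralDiff t f = fun x => finiteDiff 2 t f (x + -t) := by
  ext x
  simp only [centralDiff, finiteDiff_two]
  ring_nf

theorem memLp_finiteDiff_one (hf : MemLp f p volume) (t : ℝ) :
    MemLp (finiteDiff 1 t f) p volume := by
  have h : finiteDiff 1 t f = (fun x => f (x + t)) - f := by ext x; simp [finiteDiff_one]
  rw [h]
  exact (hf.comp_measurePreserving (measurePreserving_add_right volume t)).sub hf

theorem memLp_finiteDiff_two (hf : MemLp f p volume) (t : ℝ) :
    MemLp (finiteDiff 2 t f) p volume := by
  rw [finiteDiff_two_eq]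
  exact memLp_finiteDiff_one (memLp_finiteDiff_one hf t) t

theorem eLpNorm_finiteDiff_one_le (hp : 1 ≤ p) (hf : MemLp f p volume) (t : ℝ) :
    eLpNorm (finiteDiff 1 t f) p volume ≤ 2 * eLpNorm f p volume := by
  have h : finiteDiff 1 t f = (fun x => f (x + t)) - f := by ext x; simp [finiteDiff_one]
  rw [h]
  refine (eLpNorm_sub_le (hf.comp_measurePreserving (measurePreserving_add_right volume t)).1
    hf.1 hp).trans (le_of_eq ?_)
  rw [two_mul]
  exact congrArg (· + _) (eLpNorm_comp_add_right hf.1 p t)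

theorem eLpNorm_finiteDiff_two_le (hp : 1 ≤ p) (hf : MemLp f p volume) (t : ℝ) :
    eLpNorm (finiteDiff 2 t f) p volume ≤ 2 * eLpNorm (finiteDiff 1 t f) p volume := by
  rw [finiteDiff_two_eq]
  exact eLpNorm_finiteDiff_one_le hp (memLp_finiteDiff_one hf t) t

theorem eLpNorm_centralDiff (hf : MemLp f p volume) (t : ℝ) :
    eLpNorm (centralDiff t f) p volume = eLpNorm (finiteDiff 2 t f) p volume := by
  rw [centralDiff_eq]
  exact eLpNorm_comp_add_right (memLp_finiteDiff_two hf t).1 p (-t)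

theorem eLpNorm_finiteDiff_one_neg (hf : MemLp f p volume) (t : ℝ) :
    eLpNorm (finiteDiff 1 (-t) f) p volume = eLpNorm (finiteDiff 1 t f) p volume := by
  have h : finiteDiff 1 (-t) f = -fun x => finiteDiff 1 t f (x + -t) := by
    ext x
    simp only [finiteDiff_one, Pi.neg_apply]
    ring_nf
  rw [h, eLpNorm_neg]
  exact eLpNorm_comp_add_right (memLp_finiteDiff_one hf t).1 p (-t)

theorem eLpNorm_finiteDiff_two_neg (hf : MemLp f p volume) (t : ℝ) :
    eLpNorm (finiteDiff 2 (-t) f) p volume = eLpNorm (finiteDiff 2 t f) p volume := by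
  rw [← eLpNorm_centralDiff hf, ← eLpNorm_centralDiff hf]
  congr 1
  ext x
  simp only [centralDiff, sub_neg_eq_add, ← sub_eq_add_neg]
  ring

theorem finiteDiff_zero_step {r : ℕ} (hr : r ≠ 0) (f : ℝ → ℝ) : finiteDiff r 0 f = 0 := by
  ext x
  simp only [finiteDiff, mul_zero, add_zero, ← Finset.sum_mul, Pi.zero_apply]
  have := (add_pow (1 : ℝ) (-1) r).symm
  simp only [one_pow, one_mul, add_neg_cancel, zero_pow hr] at this
  rw [Finset.sum_congr rfl fun j _ => mul_comm ((r.choose j : ℝ)) _, this, zero_mul]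

end FiniteDiff

/-! ### The strong converse inequality -/

/-- The strong converse inequality: second differences with step `1 / w` are controlled by the
error of the Durrmeyer operator at the same `w`. -/
theorem exists_eLpNorm_finiteDiff_two_le {n : ℕ} (hn : 2 ≤ n) {p : ℝ≥0∞} (hp : 1 ≤ p) :
    ∃ c : ℝ, 0 < c ∧ ∀ f : ℝ → ℝ, Measurable f → MemLp f p volume → ∀ w : ℝ, 0 < w →
      eLpNorm (finiteDiff 2 w⁻¹ f) p volume ≤ ENNReal.ofReal c *
        eLpNorm (fun x => durrmeyer (centralBSpline n) (centralBSpline n) w f x - f x)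
          p volume := by
  obtain ⟨k, Q, hk, hPQ, hQ⟩ := exists_symbol_factorization (n := n) (m := 2 * n + 1)
    (β := fun j => splineCorrelation n (j - n)) (fun j => splineCorrelation_nonneg hn _)
    (sum_splineCorrelation hn) (by omega) (by
      have := splineCorrelation_one_pos hn
      simpa using this)
  obtain ⟨c, hc, hcQ⟩ := exists_le_eLpNorm_aeval_translation hp Q hQ
  refine ⟨4 * (c⁻¹ * (2 * n)) + 4, by positivity, fun f hfm hf w hw => ?_⟩
  set D := durrmeyer (centralBSpline n) (centralBSpline n) w with hD
  have hfD : MemLp (D f) p volume := memLp_durrmeyer hn hw hfm hp hf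
  have hDm : Measurable (D f) := measurable_durrmeyer hn
  have hE : MemLp (fun x => D f x - f x) p volume := hfD.sub hf
  set ε := eLpNorm (fun x => D f x - f x) p volume with hε
  set T := translation w⁻¹ with hT
  set φ : ℝ → ℂ := fun x => (D f x : ℂ) with hφ
  have hφL : MemLp φ p volume := hfD.ofReal
  have h1 : eLpNorm (Polynomial.aeval T (Q * (Polynomial.X - Polynomial.C 1) ^ k) φ) p volume ≤
      ENNReal.ofReal (2 * n) * ε := by
    -- the shift by `n` makes the exponents of the convolution nonnegative
    have h2 : Polynomial.aeval T (Q * (Polynomial.X - Polynomial.C 1) ^ k) φ =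
        fun x => ((-D (fun u => D f u - f u) (x + n * w⁻¹) : ℝ) : ℂ) := by
      rw [← hPQ]
      ext x
      have h3 := durrmeyer_sub hn hw (hfD.locallyIntegrable hp) (hf.locallyIntegrable hp)
        (x + n * w⁻¹)
      have h4 := durrmeyer_durrmeyer hn hw f (x + n * w⁻¹)
      rw [← hD] at h3 h4
      rw [h3, h4]
      simp only [map_sub, map_sum, map_mul, map_pow, Polynomial.aeval_X, Polynomial.aeval_C,
        LinearMap.sub_apply, LinearMap.sum_apply, Module.End.mul_apply,
        Module.algebraMap_end_apply, Pi.sub_apply, Finset.sum_apply, Pi.smul_apply, hT,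
        translation_pow_apply, smul_eq_mul, hφ]
      push_cast
      rw [neg_sub]
      congr 1
      refine Finset.sum_congr rfl fun j _ => ?_
      congr 3
      ring
    have h5 := eLpNorm_durrmeyer_le hn hw (hDm.sub hfm) hp hE
    rw [h2]
    refine le_trans (le_of_eq ?_) h5
    rw [← eLpNorm_comp_add_right (measurable_durrmeyer hn).aestronglyMeasurable p (n * w⁻¹)]
    refine eLpNorm_congr_norm_ae (ae_of_all _ fun x => ?_)
    rw [Complex.norm_real, norm_neg]
    rfl
  set S := Polynomial.aeval T (Polynomial.X - Polynomial.C (1 : ℂ)) with hS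
  have hSm : ∀ ψ : ℝ → ℂ, MemLp ψ p volume → MemLp (S ψ) p volume := fun ψ hψ =>
    memLp_aeval_translation hψ _ _
  have hS2 : ∀ ψ : ℝ → ℂ, MemLp ψ p volume → eLpNorm (S ψ) p volume ≤ 2 * eLpNorm ψ p volume := by
    intro ψ hψ
    rw [hS, aeval_translation_X_sub_C, one_smul]
    refine (eLpNorm_sub_le (memLp_translation hψ _).1 hψ.1 hp).trans (le_of_eq ?_)
    rw [eLpNorm_translation hψ, two_mul]
  have h6 : eLpNorm ((S ^ k) φ) p volume ≤ ENNReal.ofReal (c⁻¹ * (2 * n)) * ε := by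
    rw [map_mul, map_pow, Module.End.mul_apply, ← hS] at h1
    have hk' : MemLp ((S ^ k) φ) p volume := by
      rw [hS, ← map_pow]
      exact memLp_aeval_translation hφL _ _
    have h7 := (hcQ w⁻¹ _ hk').trans h1
    calc eLpNorm ((S ^ k) φ) p volume
        = ENNReal.ofReal c⁻¹ * (ENNReal.ofReal c * eLpNorm ((S ^ k) φ) p volume) := by
          rw [← mul_assoc, ← ENNReal.ofReal_mul (by positivity), inv_mul_cancel₀ hc.ne',
            ENNReal.ofReal_one, one_mul]
      _ ≤ ENNReal.ofReal c⁻¹ * (ENNReal.ofReal (2 * n) * ε) := mul_le_mul_right h7 _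
      _ = _ := by rw [← mul_assoc, ← ENNReal.ofReal_mul (by positivity)]
  -- the multiplicity `k` may be smaller than two; the missing factors `T - 1` are bounded
  have h8 : eLpNorm ((S ^ 2) φ) p volume ≤ 4 * eLpNorm ((S ^ k) φ) p volume := by
    have h9 : (4 : ℝ≥0∞) = 2 * 2 := by norm_num
    interval_cases k
    · rw [pow_two, Module.End.mul_apply, pow_zero, Module.End.one_apply, h9, mul_assoc]
      exact (hS2 _ (hSm _ hφL)).trans (mul_le_mul_right (hS2 _ hφL) _)
    · rw [pow_two, Module.End.mul_apply, pow_one]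
      exact (hS2 _ (hSm _ hφL)).trans (mul_le_mul_left (by norm_num) _)
    · exact le_mul_of_one_le_left' (by norm_num)
  have h10 : eLpNorm (finiteDiff 2 w⁻¹ (D f)) p volume = eLpNorm ((S ^ 2) φ) p volume := by
    refine eLpNorm_congr_norm_ae (ae_of_all _ fun x => ?_)
    rw [pow_two, Module.End.mul_apply, hS, aeval_translation_X_sub_C, aeval_translation_X_sub_C,
      finiteDiff_two, ← Complex.norm_real]
    simp only [one_smul, Pi.sub_apply, translation_apply, hφ]
    rw [show x + w⁻¹ + w⁻¹ = x + 2 * w⁻¹ by ring]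
    congr 1
    push_cast
    ring
  have h11 : finiteDiff 2 w⁻¹ f =
      finiteDiff 2 w⁻¹ (D f) - finiteDiff 2 w⁻¹ (fun x => D f x - f x) := by
    ext x
    simp only [Pi.sub_apply, finiteDiff_two]
    ring
  rw [h11]
  calc _ ≤ eLpNorm (finiteDiff 2 w⁻¹ (D f)) p volume +
        eLpNorm (finiteDiff 2 w⁻¹ (fun x => D f x - f x)) p volume :=
        eLpNorm_sub_le (memLp_finiteDiff_two hfD _).1 (memLp_finiteDiff_two hE _).1 hp
    _ ≤ 4 * (ENNReal.ofReal (c⁻¹ * (2 * n)) * ε) + 2 * (2 * ε) := by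
        rw [h10]
        exact add_le_add (h8.trans (mul_le_mul_right h6 _))
          ((eLpNorm_finiteDiff_two_le hp hE _).trans
            (mul_le_mul_right (eLpNorm_finiteDiff_one_le hp hE _) _))
    _ = ENNReal.ofReal (4 * (c⁻¹ * (2 * n)) + 4) * ε := by
        rw [ENNReal.ofReal_add (by positivity) (by positivity),
          ENNReal.ofReal_mul (p := 4) (by positivity)]
        simp only [ENNReal.ofReal_ofNat]
        rw [add_mul, mul_assoc, ← mul_assoc 2 2 ε]
        norm_num

/-! ### From second to first differences -/

/-- A Marchaud type inequality: for `α < 1`, second differences of order `t ^ α` force first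
differences of order `t ^ α`, by iterating `2 Δ_t = Δ_{2t} - Δ_t²`. -/
theorem exists_eLpNorm_finiteDiff_one_le {p : ℝ≥0∞} (hp : 1 ≤ p) {f : ℝ → ℝ}
    (hf : MemLp f p volume) {α : ℝ} (hα0 : 0 < α) (hα1 : α < 1) {C δ₀ : ℝ} (hC : 0 ≤ C)
    (hδ₀ : 0 < δ₀)
    (h : ∀ t, 0 < t → t < δ₀ → eLpNorm (finiteDiff 2 t f) p volume ≤ ENNReal.ofReal (C * t ^ α)) :
    ∃ C' : ℝ, 0 ≤ C' ∧ ∀ t, 0 < t → t < δ₀ →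
      eLpNorm (finiteDiff 1 t f) p volume ≤ ENNReal.ofReal (C' * t ^ α) := by
  set N : ℝ := (eLpNorm f p volume).toReal with hN
  have hNe : eLpNorm f p volume = ENNReal.ofReal N := (ENNReal.ofReal_toReal hf.2.ne).symm
  have hN0 : 0 ≤ N := ENNReal.toReal_nonneg
  set ρ : ℝ := 1 - 2 ^ α / 2 with hρ
  have h2α : (2 : ℝ) ^ α < 2 := by
    simpa using Real.rpow_lt_rpow_of_exponent_lt (by norm_num : (1 : ℝ) < 2) hα1
  have h2α0 : (0 : ℝ) < 2 ^ α := by positivity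
  have hρ0 : 0 < ρ := by rw [hρ]; linarith
  -- `K = C / (2 - 2 ^ α)` reproduces itself in the recursion; the second term covers large steps
  set K : ℝ := C / (2 * ρ) + 2 * N / (δ₀ / 2) ^ α with hK
  have hK0 : 0 ≤ K := by positivity
  have hbig : ∀ t, δ₀ / 2 ≤ t →
      eLpNorm (finiteDiff 1 t f) p volume ≤ ENNReal.ofReal (K * t ^ α) := by
    intro t ht
    refine (eLpNorm_finiteDiff_one_le hp hf t).trans ?_
    rw [hNe, ← ENNReal.ofReal_ofNat, ← ENNReal.ofReal_mul (by norm_num)]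
    refine ENNReal.ofReal_le_ofReal ?_
    have h1 : (δ₀ / 2) ^ α ≤ t ^ α := Real.rpow_le_rpow (by positivity) ht hα0.le
    calc 2 * N = 2 * N / (δ₀ / 2) ^ α * (δ₀ / 2) ^ α := by field_simp
      _ ≤ K * t ^ α := by
        refine mul_le_mul ?_ h1 (by positivity) hK0
        rw [hK]
        exact le_add_of_nonneg_left (by positivity)
  have hmain : ∀ m : ℕ, ∀ t, 0 < t → δ₀ / 2 ≤ 2 ^ m * t →
      eLpNorm (finiteDiff 1 t f) p volume ≤ ENNReal.ofReal (K * t ^ α) := by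
    intro m
    induction m with
    | zero => exact fun t _ h1 => hbig t (by simpa using h1)
    | succ m ih =>
      intro t ht h1
      by_cases hlt : δ₀ / 2 ≤ t
      · exact hbig t hlt
      have h2 := ih (2 * t) (by positivity) (by rw [pow_succ] at h1; linarith)
      have h3 := h t ht (by linarith)
      have h4 : finiteDiff 1 t f = (2⁻¹ : ℝ) • (finiteDiff 1 (2 * t) f - finiteDiff 2 t f) := by
        ext x
        simp only [Pi.smul_apply, Pi.sub_apply, finiteDiff_one, finiteDiff_two, smul_eq_mul]
        ring
      rw [h4, eLpNorm_const_smul, Real.enorm_of_nonneg (by norm_num)]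
      refine (mul_le_mul_right ((eLpNorm_sub_le (memLp_finiteDiff_one hf _).1
        (memLp_finiteDiff_two hf _).1 hp).trans (add_le_add h2 h3)) _).trans ?_
      rw [← ENNReal.ofReal_add (by positivity) (by positivity),
        ← ENNReal.ofReal_mul (by norm_num)]
      refine ENNReal.ofReal_le_ofReal ?_
      rw [Real.mul_rpow (by norm_num) ht.le]
      have h5 : C ≤ 2 * ρ * K := by
        rw [hK, mul_add, mul_div_cancel₀ _ (by positivity)]
        exact le_add_of_nonneg_right (by positivity)
      have h6 : (2 : ℝ) ^ α = 2 - 2 * ρ := by rw [hρ]; ring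
      have h7 : 0 < t ^ α := Real.rpow_pos_of_pos ht α
      rw [h6]
      nlinarith
  refine ⟨K, hK0, fun t ht _ => ?_⟩
  obtain ⟨m, hm⟩ := pow_unbounded_of_one_lt (δ₀ / 2 / t) (by norm_num : (1 : ℝ) < 2)
  exact hmain m t ht (by rw [div_lt_iff₀ ht] at hm; exact hm.le)

/-! ### Characterization of the Lipschitz spaces -/

section Congr

variable {f g : ℝ → ℝ}

theorem durrmeyer_congr_ae (φ ψ : ℝ → ℝ) (w : ℝ) (h : f =ᵐ[volume] g) :
    durrmeyer φ ψ w f = durrmeyer φ ψ w g := by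
  ext x
  unfold durrmeyer
  refine tsum_congr fun k => ?_
  congr 2
  refine integral_congr_ae ?_
  filter_upwards [h] with u hu
  rw [hu]

theorem finiteDiff_congr_ae (r : ℕ) (t : ℝ) (h : f =ᵐ[volume] g) :
    finiteDiff r t f =ᵐ[volume] finiteDiff r t g := by
  have h1 : ∀ᵐ x ∂volume, ∀ j : ℕ, f (x + j * t) = g (x + j * t) :=
    ae_all_iff.2 fun j =>
      (measurePreserving_add_right volume ((j : ℝ) * t)).quasiMeasurePreserving.ae_eq_comp h
  filter_upwards [h1] with x hx
  exact Finset.sum_congr rfl fun j _ => by rw [hx j]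

theorem modulusOfSmoothness_congr_ae (r : ℕ) (p : ℝ≥0∞) (δ : ℝ) (h : f =ᵐ[volume] g) :
    modulusOfSmoothness r p f δ = modulusOfSmoothness r p g δ := by
  unfold modulusOfSmoothness
  simp only [eLpNorm_congr_ae (finiteDiff_congr_ae r _ h)]

end Congr

variable {f : ℝ → ℝ} {p : ℝ≥0∞} {α : ℝ}

theorem eLpNorm_finiteDiff_le_modulusOfSmoothness (r : ℕ) {t δ : ℝ} (ht : |t| ≤ δ) :
    eLpNorm (finiteDiff r t f) p volume ≤ modulusOfSmoothness r p f δ :=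
  le_iSup₂ (f := fun (s : ℝ) (_ : |s| ≤ δ) => eLpNorm (finiteDiff r s f) p volume) t ht

/-- It suffices to bound the moduli of smoothness on differences with positive steps. -/
theorem modulusOfSmoothness_le {r : ℕ} (hr : r = 1 ∨ r = 2) (hf : MemLp f p volume)
    (hα0 : 0 < α) {C δ : ℝ} (hC : 0 ≤ C)
    (h : ∀ t, 0 < t → t ≤ δ → eLpNorm (finiteDiff r t f) p volume ≤ ENNReal.ofReal (C * t ^ α)) :
    modulusOfSmoothness r p f δ ≤ ENNReal.ofReal (C * δ ^ α) := by
  have hpos : ∀ t, 0 < t → t ≤ δ →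
      eLpNorm (finiteDiff r t f) p volume ≤ ENNReal.ofReal (C * δ ^ α) := fun t h0 h1 =>
    (h t h0 h1).trans (ENNReal.ofReal_le_ofReal
      (mul_le_mul_of_nonneg_left (Real.rpow_le_rpow h0.le h1 hα0.le) hC))
  refine iSup₂_le fun t ht => ?_
  have ht' := abs_le.1 ht
  rcases lt_trichotomy t 0 with h0 | h0 | h0
  · have h2 := hpos (-t) (by linarith) (by linarith)
    rcases hr with rfl | rfl
    · rwa [eLpNorm_finiteDiff_one_neg hf] at h2
    · rwa [eLpNorm_finiteDiff_two_neg hf] at h2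
  · rw [h0, finiteDiff_zero_step (by omega), eLpNorm_zero]
    exact zero_le
  · exact hpos t h0 ht'.2

/-- For `0 < α < 2`, membership in the Lipschitz space is decided by second differences. -/
theorem mem_LipStar_iff_finiteDiff_two (hp : 1 ≤ p) (hf : MemLp f p volume) (hα0 : 0 < α)
    (hα2 : α < 2) :
    f ∈ LipStar α p ↔ ∃ C δ₀ : ℝ, 0 ≤ C ∧ 0 < δ₀ ∧ ∀ t, 0 < t → t < δ₀ →
      eLpNorm (finiteDiff 2 t f) p volume ≤ ENNReal.ofReal (C * t ^ α) := by
  have hfloor : α < 1 ∧ ⌊α⌋₊ = 0 ∨ 1 ≤ α ∧ ⌊α⌋₊ = 1 := by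
    rcases lt_or_ge α 1 with h | h
    · exact Or.inl ⟨h, Nat.floor_eq_zero.2 h⟩
    · exact Or.inr ⟨h, (Nat.floor_eq_iff hα0.le).2 ⟨by simpa using h, by norm_num; exact hα2⟩⟩
  constructor
  · rintro ⟨_, C, hC⟩
    obtain ⟨δ₀, hδ₀, hδ⟩ := mem_nhdsGT_iff_exists_Ioo_subset.1 hC
    refine ⟨2 * |C|, δ₀, by positivity, hδ₀, fun t ht0 ht1 => ?_⟩
    have h1 := hδ (show t ∈ Set.Ioo 0 δ₀ from ⟨ht0, ht1⟩)
    simp only [Set.mem_ofPred_eq] at h1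
    have htα : 0 ≤ t ^ α := Real.rpow_nonneg ht0.le α
    have h2 := (eLpNorm_finiteDiff_le_modulusOfSmoothness (⌊α⌋₊ + 1)
      (abs_of_pos ht0).le).trans h1
    have h3 : ENNReal.ofReal (C * t ^ α) ≤ ENNReal.ofReal (|C| * t ^ α) :=
      ENNReal.ofReal_le_ofReal (mul_le_mul_of_nonneg_right (le_abs_self C) htα)
    have h4 : ENNReal.ofReal (2 * |C| * t ^ α) = 2 * ENNReal.ofReal (|C| * t ^ α) := by
      rw [mul_assoc, ENNReal.ofReal_mul (by norm_num), ENNReal.ofReal_ofNat]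
    rw [h4]
    rcases hfloor with ⟨_, h5⟩ | ⟨_, h5⟩ <;> rw [h5] at h2
    · exact (eLpNorm_finiteDiff_two_le hp hf t).trans (mul_le_mul_right (h2.trans h3) _)
    · exact (h2.trans h3).trans (le_mul_of_one_le_left' (by norm_num))
  · rintro ⟨C, δ₀, hC, hδ₀, h⟩
    obtain ⟨C', hC', h'⟩ : ∃ C' : ℝ, 0 ≤ C' ∧ ∀ t, 0 < t → t < δ₀ →
        eLpNorm (finiteDiff (⌊α⌋₊ + 1) t f) p volume ≤ ENNReal.ofReal (C' * t ^ α) := by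
      rcases hfloor with ⟨h1, h5⟩ | ⟨_, h5⟩ <;> rw [h5]
      · exact exists_eLpNorm_finiteDiff_one_le hp hf hα0 h1 hC hδ₀ h
      · exact ⟨C, hC, h⟩
    refine ⟨hf, C', ?_⟩
    filter_upwards [Ioo_mem_nhdsGT hδ₀] with δ hδ
    refine modulusOfSmoothness_le ?_ hf hα0 hC' fun t ht0 ht1 => h' t ht0 (ht1.trans_lt hδ.2)
    rcases hfloor with ⟨_, h5⟩ | ⟨_, h5⟩ <;> simp [h5]

/-- Measurability of `f`, as opposed to almost everywhere measurability, makes the averages over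
translates of `f` jointly measurable. -/
theorem mem_LipStar_iff_durrmeyer_of_measurable {n : ℕ} (hn : 2 ≤ n) (hp : 1 ≤ p)
    (hfm : Measurable f) (hf : MemLp f p volume) (hα0 : 0 < α) (hα2 : α < 2) :
    f ∈ LipStar α p ↔
      ∃ C : ℝ, ∀ᶠ w : ℝ in atTop,
        eLpNorm (fun x => durrmeyer (centralBSpline n) (centralBSpline n) w f x - f x) p volume
          ≤ ENNReal.ofReal (C * w ^ (-α)) := by
  rw [mem_LipStar_iff_finiteDiff_two hp hf hα0 hα2]
  have hpow : ∀ w : ℝ, 0 < w → w⁻¹ ^ α = w ^ (-α) := fun w hw => by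
    rw [Real.inv_rpow hw.le, Real.rpow_neg hw.le]
  constructor
  · rintro ⟨C, δ₀, hC, hδ₀, h⟩
    refine ⟨(4 * n ^ 3 + 2 * n + 1) * C, ?_⟩
    filter_upwards [eventually_gt_atTop δ₀⁻¹] with w hw
    have hw0 : 0 < w := (inv_pos.2 hδ₀).trans hw
    have hwδ : w⁻¹ < δ₀ := inv_lt_of_inv_lt₀ hδ₀ hw
    have h1 := eLpNorm_durrmeyer_sub_le hn hfm hp hf hw0
      (M := ENNReal.ofReal (C * w⁻¹ ^ α)) ENNReal.ofReal_ne_top (fun s hs => by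
        rw [eLpNorm_centralDiff hf]
        refine (h s hs.1 (hs.2.trans_lt hwδ)).trans (ENNReal.ofReal_le_ofReal ?_)
        exact mul_le_mul_of_nonneg_left (Real.rpow_le_rpow hs.1.le hs.2 hα0.le) hC)
    rwa [← ENNReal.ofReal_mul (by positivity), ← mul_assoc, hpow w hw0] at h1
  · rintro ⟨C, hC⟩
    obtain ⟨c, hc, hcf⟩ := exists_eLpNorm_finiteDiff_two_le hn hp
    obtain ⟨W, hW⟩ := eventually_atTop.1 hC
    refine ⟨c * |C|, (max W 1)⁻¹, by positivity, by positivity, fun t ht0 ht1 => ?_⟩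
    have htW : max W 1 < t⁻¹ := lt_inv_of_lt_inv₀ ht0 ht1
    have h1 := hcf f hfm hf t⁻¹ (inv_pos.2 ht0)
    rw [inv_inv] at h1
    refine h1.trans ((mul_le_mul_right (hW t⁻¹ ((le_max_left _ _).trans htW.le)) _).trans ?_)
    rw [← hpow _ (inv_pos.2 ht0), inv_inv, ← ENNReal.ofReal_mul hc.le, mul_assoc]
    refine ENNReal.ofReal_le_ofReal (mul_le_mul_of_nonneg_left ?_ hc.le)
    exact mul_le_mul_of_nonneg_right (le_abs_self C) (Real.rpow_nonneg ht0.le α)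

theorem mainTheorem9 (n : ℕ) (hn : 2 ≤ n) (p : ℝ≥0∞) (hp : 1 ≤ p)
    (f : ℝ → ℝ) (hf : MemLp f p volume) (α : ℝ) (hα0 : 0 < α) (hα2 : α < 2) :
    f ∈ LipStar α p ↔
      ∃ C : ℝ, ∀ᶠ w : ℝ in atTop,
        eLpNorm (fun x => durrmeyer (centralBSpline n) (centralBSpline n) w f x - f x) p volume
          ≤ ENNReal.ofReal (C * w ^ (-α)) := by
  -- both sides depend only on the class of `f` modulo null sets
  set g := hf.1.mk f with hg
  have hfg : f =ᵐ[volume] g := hf.1.ae_eq_mk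
  have hgL : MemLp g p volume := hf.ae_eq hfg
  have h1 : f ∈ LipStar α p ↔ g ∈ LipStar α p := by
    simp only [LipStar, Set.mem_ofPred_eq, modulusOfSmoothness_congr_ae _ p _ hfg, hf, hgL]
  have h2 : ∀ w, eLpNorm (fun x =>
        durrmeyer (centralBSpline n) (centralBSpline n) w f x - f x) p volume =
      eLpNorm (fun x =>
        durrmeyer (centralBSpline n) (centralBSpline n) w g x - g x) p volume := by
    intro w
    refine eLpNorm_congr_ae ?_
    filter_upwards [hfg] with x hx
    rw [hx, durrmeyer_congr_ae _ _ w hfg]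
  simp only [h1, h2]
  exact mem_LipStar_iff_durrmeyer_of_measurable hn hp hf.1.stronglyMeasurable_mk.measurable hgL
    hα0 hα2
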